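/- Let $\lambda>0$, $\mathbb{R}_+=(0,\infty)$, $dm_\lambda(x)=x^{2\lambda}\,dx$ on $\mathbb{R}_+$, and let $\mu_\lambda=m_\lambda\times m_\lambda$ on $\mathbb{R}_+\times\mathbb{R}_+$; write $\mathbb{R}_\lambda=(\mathbb{R}_+\times\mathbb{R}_+,\mu_\lambda)$. A rectangle is a set $R=I_1\times I_2$, where $I_1,I_2$ are intervals of the form $(x-t,x+t)\cap\mathbb{R}_+$ with $x,t>0$. For $q\in(1,\infty]$, a $q$-atom is a function $a\in L^q(\mathbb{R}_\lambda)$, complex valued, supported on a rectangle $R$, with $\|a\|_{L^q(\mathbb{R}_\lambda)}\le\mu_\lambda(R)^{1/q-1}$ and $\int_{\mathbb{R}_+\times\mathbb{R}_+}a\,d\mu_\lambda=0$. The space $h^{1,q}(\mathbb{R}_\lambda)$ consists of all $f=\sum_i\alpha_ia_i$ (convergence in $L^1(\mathbb{R}_\lambda)$) with $q$-atoms $a_i$ and $\alpha_i\in\mathbb{C}$, $\sum_i|\alpha_i|<\infty$, and $\|f\|_{h^{1,q}(\mathbb{R}_\lambda)}=\inf\sum_i|\alpha_i|$, the infimum being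 taken over all such decompositions of $f$. Theorem. Let $q\in(1,\infty)$. Then $h^{1,q}(\mathbb{R}_\lambda)=h^{1,\infty}(\mathbb{R}_\lambda)$ with equivalent norms: there are constants $c,C>0$, depending only on $\lambda$ and $q$, such that $c\,\|f\|_{h^{1,\infty}(\mathbb{R}_\lambda)}\le\|f\|_{h^{1,q}(\mathbb{R}_\lambda)}\le C\,\|f\|_{h^{1,\infty}(\mathbb{R}_\lambda)}$ for all $f$ in this space. -/

import Mathlib

open MeasureTheory Set Filter Topology
open scoped ENNReal

noncomputable section

namespace Bessel

/-- The measure `dm_lam(x) = x ^ (2 * lam) dx` on `ℝ₊ = (0, ∞)`, as a measure on `ℝ` which does not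
charge the complement of `(0, ∞)`. -/
def measure (lam : ℝ) : Measure ℝ :=
  (volume.restrict (Ioi (0 : ℝ))).withDensity fun x => ENNReal.ofReal (x ^ (2 * lam))

/-- The product measure `dμ_lam(x₁, x₂) = dm_lam(x₁) × dm_lam(x₂)` on `ℝ₊ × ℝ₊`. -/
def prodMeasure (lam : ℝ) : Measure (ℝ × ℝ) :=
  (measure lam).prod (measure lam)

/-- The interval `I(x, t) = (x - t, x + t) ∩ ℝ₊`. -/
def interval (x t : ℝ) : Set ℝ :=
  Ioo (x - t) (x + t) ∩ Ioi 0

/-- A rectangle in `ℝ₊ × ℝ₊`: a product of two intervals `I(x₁, t₁) × I(x₂, t₂)` with centres in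
`ℝ₊` and positive radii. -/
def IsRectangle (R : Set (ℝ × ℝ)) : Prop :=
  ∃ x₁ t₁ x₂ t₂ : ℝ, 0 < x₁ ∧ 0 < t₁ ∧ 0 < x₂ ∧ 0 < t₂ ∧ R = interval x₁ t₁ ×ˢ interval x₂ t₂

/-- A `q`-atom: a function in `L^q(μ_lam)` which vanishes (almost everywhere) outside a rectangle
`R`, with `‖a‖_q ≤ μ_lam(R) ^ (1 / q - 1)` and `∫ a dμ_lam = 0`.
For `q = ∞` the exponent is `-1`. -/
def IsAtom (lam : ℝ) (q : ℝ≥0∞) (a : ℝ × ℝ → ℂ) : Prop :=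
  MemLp a q (prodMeasure lam) ∧
  (∃ R : Set (ℝ × ℝ), IsRectangle R ∧
    (∀ᵐ x ∂(prodMeasure lam), x ∉ R → a x = 0) ∧
    eLpNorm a q (prodMeasure lam) ≤ prodMeasure lam R ^ ((q⁻¹).toReal - 1)) ∧
  ∫ x, a x ∂(prodMeasure lam) = 0

/-- `f = ∑ i, α i • a i` is an atomic decomposition: the `a i` are `q`-atoms, `∑ i, |α i| < ∞`, and
the series converges to `f` in `L¹(μ_lam)`. -/
def IsAtomicDecomposition (lam : ℝ) (q : ℝ≥0∞) (f : Lp ℂ 1 (prodMeasure lam))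
    (α : ℕ → ℂ) (a : ℕ → ℝ × ℝ → ℂ) : Prop :=
  (∀ i, IsAtom lam q (a i)) ∧
  (Summable fun i => ‖α i‖) ∧
  Tendsto (fun n => eLpNorm (fun x => f x - ∑ i ∈ Finset.range n, α i * a i x) 1 (prodMeasure lam))
    atTop (𝓝 0)

/-- The atomic little Hardy space `h^{1,q}`, whose elements are classes of functions modulo equality
almost everywhere. -/
def littleHardy (lam : ℝ) (q : ℝ≥0∞) : Set (Lp ℂ 1 (prodMeasure lam)) :=
  {f | ∃ α a, IsAtomicDecomposition lam q f α a}

/-- The norm of `h^{1,q}`: the infimum of `∑ i, |α i|` over all atomic decompositions. -/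
def littleHardyNorm (lam : ℝ) (q : ℝ≥0∞) (f : Lp ℂ 1 (prodMeasure lam)) : ℝ :=
  sInf {s : ℝ | ∃ α a, IsAtomicDecomposition lam q f α a ∧ s = ∑' i, ‖α i‖}

end Bessel

end

/-! By Hölder on its rectangle every `∞`-atom is a `q`-atom, which gives one inclusion with constant
`1`. For the other it suffices to write each `q`-atom `f` on `R` as `C` times an `∞`-atom plus a
series of `q`-atoms with coefficients of total size at most `1 / 2`, where `C` depends only on `q`.
Applying this again to the error, and so on, gives errors tending to `0` in `L¹` and a geometric
series of `∞`-atomic norms (`IsAtomicSum.of_approx`).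

The splitting is a Calderón–Zygmund decomposition of `|f|^q` at height `B μ(R)^(-q)`
(`IsDyadicGrid.exists_approx`). The bad parts are `f` minus its mean on stopping cells. They are
multiples of `q`-atoms and their coefficients add up to at most `2 C / B`, where `C = (4 B)^(1/q)`.
Since `q > 1`, this is at most `1 / 2` for large `B`. The good part is bounded by `C / μ(R)`.

The rectangles may be arbitrarily eccentric, so the decomposition uses only a grid adapted to `R`.
In each variable the normalised distribution function carries the weighted measure on the side of
`R` to Lebesgue measure on `(0, 1)`. Dyadic squares therefore pull back to rectangles (up to null
sets), each generation splits into four pieces of equal measure, and Lebesgue differentiation on the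
unit square transfers to `R`. -/

noncomputable section

namespace Bessel

/-! ### Abstract atomic sums and the iteration argument -/

section AtomicSum

variable {E : Type*} [NormedAddCommGroup E] [NormedSpace ℂ E]

/-- `f` is the sum of a series `∑ i, α i • u i` with `u i ∈ S` and `∑ i, ‖α i‖ ≤ c`. -/
def IsAtomicSum (S : Set E) (c : ℝ) (f : E) : Prop :=
  ∃ (α : ℕ → ℂ) (u : ℕ → E), (∀ i, u i ∈ S) ∧ (Summable fun i => ‖α i‖) ∧
    ∑' i, ‖α i‖ ≤ c ∧ HasSum (fun i => α i • u i) f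

lemma IsAtomicSum.smul {S : Set E} {c : ℝ} {f : E} (h : IsAtomicSum S c f) (z : ℂ) :
    IsAtomicSum S (‖z‖ * c) (z • f) := by
  obtain ⟨α, u, hu, hα, hc, hf⟩ := h
  refine ⟨fun i => z * α i, u, hu, ?_, ?_, ?_⟩
  · simpa [norm_mul] using hα.mul_left ‖z‖
  · simp only [norm_mul, tsum_mul_left]
    gcongr
  · simpa [mul_smul] using hf.const_smul z

variable {S T : Set E}

lemma summable_smul_of_norm_le_one [CompleteSpace E] (hS : ∀ u ∈ S, ‖u‖ ≤ 1) {ι : Type*}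
    {α : ι → ℂ} {u : ι → E} (hu : ∀ i, u i ∈ S) (hα : Summable fun i => ‖α i‖) :
    Summable fun i => ‖α i • u i‖ :=
  hα.of_nonneg_of_le (fun _ => norm_nonneg _) fun i => by
    rw [norm_smul]
    exact mul_le_of_le_one_right (norm_nonneg _) (hS _ (hu i))

lemma IsAtomicSum.norm_le [CompleteSpace E] (hS : ∀ u ∈ S, ‖u‖ ≤ 1) {c : ℝ} {f : E}
    (h : IsAtomicSum S c f) : ‖f‖ ≤ c := by
  obtain ⟨α, u, hu, hα, hc, hf⟩ := h
  have hs := summable_smul_of_norm_le_one hS hu hα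
  rw [← hf.tsum_eq]
  refine (norm_tsum_le_tsum_norm hs).trans ((hs.tsum_le_tsum (fun i => ?_) hα).trans hc)
  rw [norm_smul]
  exact mul_le_of_le_one_right (norm_nonneg _) (hS _ (hu i))

/-- The double series of coefficients is absolutely summable and the atoms lie in the unit ball, so
the double series of vectors can be summed by rows or along any enumeration of `ℕ × ℕ`. -/
lemma IsAtomicSum.hasSum [CompleteSpace E] (hS : ∀ u ∈ S, ‖u‖ ≤ 1) {c : ℕ → ℝ} {C : ℝ}
    {f : ℕ → E} {g : E} (hf : ∀ n, IsAtomicSum S (c n) (f n)) (hc : HasSum c C)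
    (hg : HasSum f g) : IsAtomicSum S C g := by
  choose α u hu hα hαc hfs using hf
  have hsum : Summable fun p : ℕ × ℕ => ‖α p.1 p.2‖ :=
    (summable_prod_of_nonneg fun _ => norm_nonneg _).2
      ⟨hα, hc.summable.of_nonneg_of_le (fun n => tsum_nonneg fun i => norm_nonneg _) hαc⟩
  obtain ⟨e⟩ : Nonempty (ℕ ≃ ℕ × ℕ) := ⟨Nat.pairEquiv.symm⟩
  refine ⟨fun i => α (e i).1 (e i).2, fun i => u (e i).1 (e i).2, fun i => hu _ _, ?_, ?_, ?_⟩
  · exact e.summable_iff.2 hsum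
  · rw [e.tsum_eq (fun p : ℕ × ℕ => ‖α p.1 p.2‖), hsum.tsum_prod' hα,
      ← hc.tsum_eq]
    exact Summable.tsum_le_tsum hαc hsum.prod hc.summable
  · have h1 : Summable fun p : ℕ × ℕ => α p.1 p.2 • u p.1 p.2 :=
      (summable_smul_of_norm_le_one hS (u := fun p : ℕ × ℕ => u p.1 p.2)
        (fun p => hu _ _) hsum).of_norm
    have h2 : HasSum (fun p : ℕ × ℕ => α p.1 p.2 • u p.1 p.2) g := by
      have := h1.hasSum
      rwa [(this.prod_fiberwise hfs).unique hg] at this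
    exact (e.hasSum_iff
      (f := fun p : ℕ × ℕ => α p.1 p.2 • u p.1 p.2)).2 h2

/-- If every element of `S` is, up to a factor `C`, an element of `T` plus an error of size `1 / 2`
in the atomic norm of `S`, then the atomic norm of `T` is dominated by that of `S`. -/
lemma IsAtomicSum.of_approx [CompleteSpace E] (hS : ∀ u ∈ S, ‖u‖ ≤ 1) (hT : ∀ u ∈ T, ‖u‖ ≤ 1)
    {C : ℝ} (hC : 0 ≤ C)
    (hST : ∀ u ∈ S, ∃ v ∈ T, IsAtomicSum S (1 / 2) (u - (C : ℂ) • v)) {c : ℝ} {f : E}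
    (hf : IsAtomicSum S c f) : IsAtomicSum T (2 * C * c) f := by
  -- One pass: approximate every atom of a decomposition at once. The errors, each of size `1 / 2`,
  -- are weighted by the same coefficients, so the bound is halved.
  have step : ∀ (c : ℝ) (f : E), IsAtomicSum S c f →
      ∃ w, IsAtomicSum S (c / 2) w ∧ IsAtomicSum T (C * c) (f - w) := by
    rintro c f ⟨α, u, hu, hα, hc, hfs⟩
    choose v hvT hv using fun i => hST (u i) (hu i)
    have hv1 : Summable fun i => α i • v i :=
      (summable_smul_of_norm_le_one hT hvT hα).of_norm
    have hcS : ∀ {S : Set E} {a b : ℝ} {f : E}, IsAtomicSum S a f → a ≤ b → IsAtomicSum S b f := by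
      rintro S a b f ⟨α, u, h1, h2, h3, h4⟩ hab
      exact ⟨α, u, h1, h2, h3.trans hab, h4⟩
    refine ⟨f - (C : ℂ) • ∑' i, α i • v i, ?_, ?_⟩
    · refine hcS (a := (∑' i, ‖α i‖) * (1 / 2)) (IsAtomicSum.hasSum hS
        (fun n => (hv n).smul (α n)) (hα.hasSum.mul_right _) ?_) (by linarith)
      have := hfs.sub (hv1.hasSum.const_smul (C : ℂ))
      convert this using 2 with i
      rw [smul_sub, smul_comm]
    · rw [sub_sub_cancel]
      have h1 : IsAtomicSum T c (∑' i, α i • v i) := ⟨α, v, hvT, hα, hc, hv1.hasSum⟩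
      simpa [abs_of_nonneg hC] using h1.smul (C : ℂ)
  -- The bound is carried along with the vector, which makes it exactly `c / 2 ^ n` after `n`
  -- passes. The differences of consecutive errors then telescope to `f`.
  let next : {p : ℝ × E // IsAtomicSum S p.1 p.2} → {p : ℝ × E // IsAtomicSum S p.1 p.2} :=
    fun p => ⟨(p.1.1 / 2, (step p.1.1 p.1.2 p.2).choose), (step p.1.1 p.1.2 p.2).choose_spec.1⟩
  let w : ℕ → {p : ℝ × E // IsAtomicSum S p.1 p.2} := fun n => next^[n] ⟨(c, f), hf⟩
  have hw : ∀ n, w (n + 1) = next (w n) := fun n => Function.iterate_succ_apply' _ _ _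
  have hwc : ∀ n, (w n).1.1 = c * (1 / 2) ^ n := by
    intro n
    induction n with
    | zero => simp [w]
    | succ n ih =>
      rw [hw, pow_succ]
      change (w n).1.1 / 2 = _
      rw [ih]; ring
  have hlim : Tendsto (fun n => (w n).1.2) atTop (𝓝 0) := by
    refine squeeze_zero_norm (fun n => (w n).2.norm_le hS) ?_
    simp only [hwc]
    simpa using (tendsto_pow_atTop_nhds_zero_of_lt_one (r := (1 / 2 : ℝ)) (by norm_num)
      (by norm_num)).const_mul c
  have hdiff : ∀ n, IsAtomicSum T (C * (c * (1 / 2) ^ n)) ((w n).1.2 - (w (n + 1)).1.2) := by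
    intro n
    rw [hw, ← hwc]
    exact (step (w n).1.1 (w n).1.2 (w n).2).choose_spec.2
  have hgeo : HasSum (fun n : ℕ => C * (c * (1 / 2 : ℝ) ^ n)) (2 * C * c) := by
    have := (hasSum_geometric_two.mul_left c).mul_left C
    rwa [show C * (c * 2) = 2 * C * c by ring] at this
  refine IsAtomicSum.hasSum hT hdiff hgeo ?_
  have hs : Summable fun n => (w n).1.2 - (w (n + 1)).1.2 :=
    Summable.of_norm (hgeo.summable.of_nonneg_of_le (fun _ => norm_nonneg _)
      fun n => (hdiff n).norm_le hT)
  have h1 := hs.hasSum.tendsto_sum_nat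
  simp only [Finset.sum_range_sub'] at h1
  have h2 : Tendsto (fun n => (w 0).1.2 - (w n).1.2) atTop (𝓝 (f - 0)) :=
    tendsto_const_nhds.sub hlim
  rw [sub_zero] at h2
  rw [← tendsto_nhds_unique h1 h2]
  exact hs.hasSum

end AtomicSum

/-! ### Uniformising the weighted measure on an interval -/

section OneDimensional

/-- The distribution function of `measure lam` on `(a, b)`, normalised to increase from `0` to
`1`. -/
def cdf (lam a b x : ℝ) : ℝ :=
  (x ^ (2 * lam + 1) - a ^ (2 * lam + 1)) / (b ^ (2 * lam + 1) - a ^ (2 * lam + 1))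

/-- The inverse of `cdf lam a b`. -/
def quantile (lam a b s : ℝ) : ℝ :=
  (a ^ (2 * lam + 1) + s * (b ^ (2 * lam + 1) - a ^ (2 * lam + 1))) ^ (2 * lam + 1)⁻¹

variable {lam a b : ℝ}

lemma rpow_sub_rpow_pos (hlam : 0 < lam) (ha : 0 ≤ a) (hab : a < b) :
    0 < b ^ (2 * lam + 1) - a ^ (2 * lam + 1) :=
  sub_pos.2 (Real.rpow_lt_rpow ha hab (by linarith))

lemma measurable_cdf : Measurable (cdf lam a b) := by
  unfold cdf; fun_prop

lemma measurable_quantile : Measurable (quantile lam a b) := by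
  unfold quantile; fun_prop

lemma cdf_strictMonoOn (hlam : 0 < lam) (ha : 0 ≤ a) (hab : a < b) :
    StrictMonoOn (cdf lam a b) (Ici 0) := by
  intro x hx y _ hxy
  have := Real.rpow_lt_rpow hx hxy (show 0 < 2 * lam + 1 by linarith)
  exact div_lt_div_of_pos_right (by linarith) (rpow_sub_rpow_pos hlam ha hab)

lemma cdf_left : cdf lam a b a = 0 := by simp [cdf]

lemma cdf_right (hlam : 0 < lam) (ha : 0 ≤ a) (hab : a < b) : cdf lam a b b = 1 :=
  div_self (rpow_sub_rpow_pos hlam ha hab).ne'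

lemma quantile_cdf (hlam : 0 < lam) (ha : 0 ≤ a) (hab : a < b) {x : ℝ} (hx : 0 ≤ x) :
    quantile lam a b (cdf lam a b x) = x := by
  have h := (rpow_sub_rpow_pos hlam ha hab).ne'
  rw [quantile, cdf, div_mul_cancel₀ _ h, add_sub_cancel, Real.rpow_rpow_inv hx (by linarith)]

lemma quantile_nonneg (hlam : 0 < lam) (ha : 0 ≤ a) (hab : a < b) {s : ℝ} (hs : 0 ≤ s) :
    0 ≤ quantile lam a b s :=
  Real.rpow_nonneg (add_nonneg (Real.rpow_nonneg ha _)
    (mul_nonneg hs (rpow_sub_rpow_pos hlam ha hab).le)) _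

lemma cdf_quantile (hlam : 0 < lam) (ha : 0 ≤ a) (hab : a < b) {s : ℝ} (hs : 0 ≤ s) :
    cdf lam a b (quantile lam a b s) = s := by
  have h := rpow_sub_rpow_pos hlam ha hab
  rw [quantile, cdf, Real.rpow_inv_rpow (add_nonneg (Real.rpow_nonneg ha _)
    (mul_nonneg hs h.le)) (by linarith), add_sub_cancel_left, mul_div_cancel_right₀ _ h.ne']

lemma cdf_mem_Ioo (hlam : 0 < lam) (ha : 0 ≤ a) (hab : a < b) {x : ℝ} (hx : x ∈ Ioo a b) :
    cdf lam a b x ∈ Ioo (0 : ℝ) 1 := by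
  have hm := cdf_strictMonoOn hlam ha hab
  have hx0 : (0 : ℝ) ≤ x := ha.trans hx.1.le
  constructor
  · rw [← cdf_left (lam := lam) (a := a) (b := b)]
    exact hm ha hx0 hx.1
  · rw [← cdf_right hlam ha hab]
    exact hm hx0 (ha.trans hab.le) hx.2

lemma Ioo_inter_preimage_cdf (hlam : 0 < lam) (ha : 0 ≤ a) (hab : a < b) {s t : ℝ} (hs : 0 ≤ s)
    (hst : s < t) (ht : t ≤ 1) :
    Ioo a b ∩ cdf lam a b ⁻¹' Ioo s t = Ioo (quantile lam a b s) (quantile lam a b t) := by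
  have hm := cdf_strictMonoOn hlam ha hab
  have hqs := quantile_nonneg hlam ha hab hs
  have hqt := quantile_nonneg hlam ha hab (hs.trans hst.le)
  have hcs := cdf_quantile hlam ha hab hs
  have hct := cdf_quantile hlam ha hab (hs.trans hst.le)
  ext x
  constructor
  · rintro ⟨hx, hx1, hx2⟩
    have hx0 : (0 : ℝ) ≤ x := ha.trans hx.1.le
    rw [← hcs] at hx1
    rw [← hct] at hx2
    exact ⟨(hm.lt_iff_lt hqs hx0).1 hx1, (hm.lt_iff_lt hx0 hqt).1 hx2⟩
  · rintro ⟨hx1, hx2⟩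
    have hx0 : (0 : ℝ) ≤ x := hqs.trans hx1.le
    have h1 := (hm.lt_iff_lt hqs hx0).2 hx1
    have h2 := (hm.lt_iff_lt hx0 hqt).2 hx2
    rw [hcs] at h1
    rw [hct] at h2
    refine ⟨⟨(hm.lt_iff_lt ha hx0).1 ?_, (hm.lt_iff_lt hx0 (ha.trans hab.le)).1 ?_⟩, h1, h2⟩
    · rw [cdf_left]; linarith
    · rw [cdf_right hlam ha hab]; linarith

lemma quantile_lt_quantile (hlam : 0 < lam) (ha : 0 ≤ a) (hab : a < b) {s t : ℝ} (hs : 0 ≤ s)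
    (hst : s < t) : quantile lam a b s < quantile lam a b t := by
  refine ((cdf_strictMonoOn hlam ha hab).lt_iff_lt (quantile_nonneg hlam ha hab hs)
    (quantile_nonneg hlam ha hab (hs.trans hst.le))).1 ?_
  rwa [cdf_quantile hlam ha hab hs, cdf_quantile hlam ha hab (hs.trans hst.le)]

lemma image_cdf_Ioo (hlam : 0 < lam) (ha : 0 ≤ a) (hab : a < b) (A : Set ℝ) :
    cdf lam a b '' (Ioo a b ∩ cdf lam a b ⁻¹' A) = Ioo 0 1 ∩ A := by
  rw [image_inter_preimage]
  congr 1
  refine Subset.antisymm (image_subset_iff.2 fun x hx => cdf_mem_Ioo hlam ha hab hx) fun s hs => ?_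
  have hs0 : (0 : ℝ) ≤ s := hs.1.le
  have hm := cdf_strictMonoOn hlam ha hab
  have hq := quantile_nonneg hlam ha hab hs0
  refine ⟨quantile lam a b s, ⟨(hm.lt_iff_lt ha hq).1 ?_,
    (hm.lt_iff_lt hq (ha.trans hab.le)).1 ?_⟩, cdf_quantile hlam ha hab hs0⟩
  · rw [cdf_left, cdf_quantile hlam ha hab hs0]; exact hs.1
  · rw [cdf_right hlam ha hab, cdf_quantile hlam ha hab hs0]; exact hs.2

lemma measure_apply_of_subset_Ioi {s : Set ℝ} (hs : MeasurableSet s) (h0 : s ⊆ Ioi 0) :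
    measure lam s = ∫⁻ x in s, ENNReal.ofReal (x ^ (2 * lam)) := by
  rw [measure, withDensity_apply _ hs, Measure.restrict_restrict hs, inter_eq_left.2 h0]

/-- Change of variables: the derivative of `cdf` is a constant multiple of the density `x ^ (2 *
lam)`. -/
lemma volume_Ioo_inter_eq_mul_measure (hlam : 0 < lam) (ha : 0 ≤ a) (hab : a < b) {A : Set ℝ}
    (hA : MeasurableSet A) :
    volume (Ioo 0 1 ∩ A) =
      ENNReal.ofReal ((2 * lam + 1) / (b ^ (2 * lam + 1) - a ^ (2 * lam + 1))) *
        measure lam (Ioo a b ∩ cdf lam a b ⁻¹' A) := by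
  have hpos := rpow_sub_rpow_pos hlam ha hab
  have hmeas : MeasurableSet (Ioo a b ∩ cdf lam a b ⁻¹' A) :=
    measurableSet_Ioo.inter (measurable_cdf hA)
  have hsub : Ioo a b ∩ cdf lam a b ⁻¹' A ⊆ Ioi 0 := fun x hx => ha.trans_lt hx.1.1
  have hderiv : ∀ x ∈ Ioo a b ∩ cdf lam a b ⁻¹' A, HasDerivWithinAt (cdf lam a b)
      ((2 * lam + 1) * x ^ (2 * lam) / (b ^ (2 * lam + 1) - a ^ (2 * lam + 1)))
      (Ioo a b ∩ cdf lam a b ⁻¹' A) x := by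
    intro x hx
    have h1 := Real.hasDerivAt_rpow_const (p := 2 * lam + 1) (Or.inl (ne_of_gt (hsub hx)))
    rw [add_sub_cancel_right] at h1
    exact ((h1.sub_const _).div_const _).hasDerivWithinAt
  have hinj : InjOn (cdf lam a b) (Ioo a b ∩ cdf lam a b ⁻¹' A) :=
    (cdf_strictMonoOn hlam ha hab).injOn.mono fun x hx => mem_Ici.2 (le_of_lt (hsub hx))
  have key := lintegral_image_eq_lintegral_abs_deriv_mul hmeas hderiv hinj fun _ => 1
  rw [image_cdf_Ioo hlam ha hab] at key
  simp only [lintegral_const, MeasurableSet.univ, Measure.restrict_apply, univ_inter, one_mul,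
    mul_one] at key
  rw [key, measure_apply_of_subset_Ioi hmeas hsub, ← lintegral_const_mul' _ _ ENNReal.ofReal_ne_top]
  refine setLIntegral_congr_fun hmeas fun x hx => ?_
  have hx0 : 0 < x := hsub hx
  have hxl : 0 ≤ x ^ (2 * lam) := Real.rpow_nonneg hx0.le _
  rw [← ENNReal.ofReal_mul (by positivity), abs_of_nonneg (by positivity)]
  congr 1
  ring

/-- The constant in the change of variables is positive and finite and the unit interval has length
`1`, which excludes both `0` and `∞`. -/
lemma measure_Ioo_pos_lt_top (hlam : 0 < lam) (ha : 0 ≤ a) (hab : a < b) :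
    0 < measure lam (Ioo a b) ∧ measure lam (Ioo a b) < ∞ := by
  have h := volume_Ioo_inter_eq_mul_measure hlam ha hab MeasurableSet.univ
  have hpos : 0 < (2 * lam + 1) / (b ^ (2 * lam + 1) - a ^ (2 * lam + 1)) :=
    div_pos (by linarith) (rpow_sub_rpow_pos hlam ha hab)
  simp only [inter_univ, Real.volume_Ioo, preimage_univ, sub_zero, ENNReal.ofReal_one] at h
  constructor
  · refine pos_iff_ne_zero.2 fun h0 => ?_
    simp [h0] at h
  · refine lt_top_iff_ne_top.2 fun h0 => ?_
    rw [h0, ENNReal.mul_top (by simpa using hpos)] at h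
    simp at h

lemma map_cdf_restrict (hlam : 0 < lam) (ha : 0 ≤ a) (hab : a < b) :
    ((measure lam).restrict (Ioo a b)).map (cdf lam a b) =
      measure lam (Ioo a b) • volume.restrict (Ioo 0 1) := by
  ext A hA
  have h1 := volume_Ioo_inter_eq_mul_measure hlam ha hab MeasurableSet.univ
  have h2 := volume_Ioo_inter_eq_mul_measure hlam ha hab hA
  simp only [inter_univ, Real.volume_Ioo, preimage_univ, sub_zero, ENNReal.ofReal_one] at h1
  rw [Measure.map_apply measurable_cdf hA, Measure.restrict_apply (measurable_cdf hA),
    Measure.smul_apply, Measure.restrict_apply hA, inter_comm A, inter_comm (_ ⁻¹' A), h2,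
    smul_eq_mul, ← mul_assoc, mul_comm (measure lam (Ioo a b)), ← h1, one_mul]

instance : SFinite (measure lam) := by
  unfold measure; infer_instance

end OneDimensional

/-! ### Abstract dyadic grids and stopping cells -/

section Grid

variable {X : Type*} {R : Set X} {π : ℕ → X → ℤ × ℤ}

/-- The set of points of `R` with the same label as `x` at level `n`. -/
def cell (R : Set X) (π : ℕ → X → ℤ × ℤ) (n : ℕ) (x : X) : Set X :=
  R ∩ π n ⁻¹' {π n x}

lemma cell_congr {n : ℕ} {x y : X} (h : π n x = π n y) : cell R π n x = cell R π n y := by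
  rw [cell, cell, h]

lemma cell_subset (n : ℕ) (x : X) : cell R π n x ⊆ R := inter_subset_left

variable [MeasurableSpace X] {ν : Measure X}

/-- The labels `π n` define a nested sequence of partitions of `R` into cells, each of which splits
into four cells of equal measure, and which satisfy a differentiation theorem. -/
structure IsDyadicGrid (ν : Measure X) (R : Set X) (π : ℕ → X → ℤ × ℤ) : Prop where
  measurableSet : MeasurableSet R
  measure_ne_zero : ν R ≠ 0
  measure_ne_top : ν R ≠ ∞
  measurable : ∀ n, Measurable (π n)
  nested : ∀ n x y, π (n + 1) x = π (n + 1) y → π n x = π n y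
  root : ∀ x ∈ R, ∀ y ∈ R, π 0 x = π 0 y
  measure_cell : ∀ n, ∀ x ∈ R, ν (cell R π n x) = (4 ^ n)⁻¹ * ν R
  le_of_average_le : ∀ h : X → ℝ≥0∞, Measurable h → ∫⁻ y in R, h y ∂ν ≠ ∞ →
    ∀ᵐ x ∂ν, x ∈ R → ∀ B : ℝ≥0∞,
      (∀ n, ∫⁻ y in cell R π n x, h y ∂ν ≤ B * ν (cell R π n x)) → h x ≤ B

namespace IsDyadicGrid

lemma label_eq_of_le (hG : IsDyadicGrid ν R π) {m n : ℕ} (hmn : m ≤ n) {x y : X}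
    (h : π n x = π n y) : π m x = π m y := by
  induction n, hmn using Nat.le_induction with
  | base => exact h
  | succ n _ ih => exact ih (hG.nested n x y h)

lemma cell_zero (hG : IsDyadicGrid ν R π) {x : X} (hx : x ∈ R) : cell R π 0 x = R :=
  inter_eq_left.2 fun y hy => hG.root y hy x hx

lemma measurableSet_cell (hG : IsDyadicGrid ν R π) (n : ℕ) (x : X) :
    MeasurableSet (cell R π n x) :=
  hG.measurableSet.inter (hG.measurable n (measurableSet_singleton _))

lemma cell_anti (hG : IsDyadicGrid ν R π) (n : ℕ) (x : X) :
    cell R π (n + 1) x ⊆ cell R π n x :=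
  fun y hy => ⟨hy.1, hG.nested n y x hy.2⟩

lemma measure_cell_eq_four_mul (hG : IsDyadicGrid ν R π) (n : ℕ) {x : X} (hx : x ∈ R) :
    ν (cell R π n x) = 4 * ν (cell R π (n + 1) x) := by
  rw [hG.measure_cell n x hx, hG.measure_cell (n + 1) x hx, ← mul_assoc, pow_succ,
    ENNReal.mul_inv (Or.inr (by simp)) (Or.inr (by simp)), mul_comm (4 : ℝ≥0∞), mul_assoc _ _ 4,
    ENNReal.inv_mul_cancel (by simp) (by simp), mul_one]

/-- The maximal cells on which the average of `h` exceeds `τ`. -/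
lemma exists_stopping_cells (hG : IsDyadicGrid ν R π) {h : X → ℝ≥0∞} (hh : Measurable h)
    {τ : ℝ≥0∞} (hτ : τ ≠ ∞) (hR : ∫⁻ y in R, h y ∂ν ≤ τ * ν R) :
    ∃ E : ℕ × ℤ × ℤ → Set X, (∀ i, MeasurableSet (E i)) ∧ Pairwise (Function.onFun Disjoint E) ∧
      (∀ i, E i = ∅ ∨ ∃ n, ∃ x ∈ R, E i = cell R π n x) ∧
      (∀ i, τ * ν (E i) ≤ ∫⁻ y in E i, h y ∂ν) ∧
      (∀ i, ∫⁻ y in E i, h y ∂ν ≤ 4 * τ * ν (E i)) ∧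
      ∀ᵐ x ∂ν, x ∈ R → (∀ i, x ∉ E i) → h x ≤ τ := by
  let bad : ℕ → X → Prop := fun n x => τ * ν (cell R π n x) < ∫⁻ y in cell R π n x, h y ∂ν
  have bad_congr : ∀ {n x y}, π n x = π n y → bad n x → bad n y := by
    intro n x y hxy hx
    simpa only [bad, cell_congr hxy] using hx
  -- Indexing by level and label makes the family countable; most of its members may be empty. A
  -- point lies in `E i` only if `i.1` is its first bad level, whence disjointness.
  let E : ℕ × ℤ × ℤ → Set X :=
    fun i => {x | x ∈ R ∧ π i.1 x = i.2 ∧ bad i.1 x ∧ ∀ m < i.1, ¬ bad m x}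
  have hE : ∀ {i x}, x ∈ E i → E i = cell R π i.1 x := by
    rintro i x ⟨hxR, hxi, hxb, hxm⟩
    ext y
    constructor
    · rintro ⟨hyR, hyi, -, -⟩
      exact ⟨hyR, hyi.trans hxi.symm⟩
    · rintro ⟨hyR, hyx⟩
      have hyx : π i.1 y = π i.1 x := hyx
      exact ⟨hyR, hyx.trans hxi, bad_congr hyx.symm hxb,
        fun m hm hb => hxm m hm (bad_congr (hG.label_eq_of_le hm.le hyx) hb)⟩
  have hcell : ∀ i, E i = ∅ ∨ ∃ n, ∃ x ∈ R, E i = cell R π n x := by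
    intro i
    rcases (E i).eq_empty_or_nonempty with h0 | ⟨x, hx⟩
    · exact Or.inl h0
    · exact Or.inr ⟨i.1, x, hx.1, hE hx⟩
  refine ⟨E, ?_, ?_, hcell, ?_, ?_, ?_⟩
  · intro i
    rcases hcell i with h0 | ⟨n, x, -, h0⟩
    · rw [h0]; exact MeasurableSet.empty
    · rw [h0]; exact hG.measurableSet_cell n x
  · intro i j hij
    refine Set.disjoint_left.2 fun x hxi hxj => hij ?_
    have h1 : i.1 = j.1 := by
      rcases lt_trichotomy i.1 j.1 with hlt | heq | hgt
      · exact absurd hxi.2.2.1 (hxj.2.2.2 _ hlt)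
      · exact heq
      · exact absurd hxj.2.2.1 (hxi.2.2.2 _ hgt)
    refine Prod.ext h1 ?_
    rw [← hxi.2.1, ← hxj.2.1, h1]
  · intro i
    rcases (E i).eq_empty_or_nonempty with h0 | ⟨x, hx⟩
    · simp [h0]
    · rw [hE hx]; exact hx.2.2.1.le
  · intro i
    rcases (E i).eq_empty_or_nonempty with h0 | ⟨x, hx⟩
    · simp [h0]
    · rw [hE hx]
      obtain ⟨hxR, -, hxb, hxm⟩ := hx
      -- Level `0` is never bad, by `hR`. At level `m + 1` the parent cell is good and has four
      -- times the measure, which is the source of the factor `4`.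
      rcases hi : i.1 with _ | m
      · rw [hi] at hxb
        simp only [bad, hG.cell_zero hxR] at hxb
        exact absurd hxb hR.not_gt
      · have hm := hxm m (by omega)
        simp only [bad, not_lt] at hm
        refine (lintegral_mono_set (hG.cell_anti m x)).trans (hm.trans_eq ?_)
        rw [hG.measure_cell_eq_four_mul m hxR]
        ring
  · have hfin : ∫⁻ y in R, h y ∂ν ≠ ∞ :=
      ne_top_of_le_ne_top (ENNReal.mul_ne_top hτ hG.measure_ne_top) hR
    filter_upwards [hG.le_of_average_le h hh hfin] with x hx hxR hxE
    refine hx hxR τ fun n => ?_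
    -- A least bad level would place `x` in a stopping cell.
    have hgood : ∀ n, ¬ bad n x := by
      intro n
      induction n using Nat.strong_induction_on with
      | _ n ih => exact fun hb => hxE (n, π n x) ⟨hxR, rfl, hb, ih⟩
    exact not_lt.1 (hgood n)

end IsDyadicGrid

end Grid

/-! ### Atoms on a fixed set and subtraction of means -/

section AtomOn

variable {X : Type*} [MeasurableSpace X] {ν : Measure X} {p q : ℝ≥0∞} {E : Set X} {a : X → ℂ}

/-- A `q`-atom supported on the set `E`. -/
def IsAtomOn (ν : Measure X) (q : ℝ≥0∞) (E : Set X) (a : X → ℂ) : Prop :=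
  MemLp a q ν ∧ (∀ᵐ x ∂ν, x ∉ E → a x = 0) ∧ eLpNorm a q ν ≤ ν E ^ ((q⁻¹).toReal - 1) ∧
    ∫ x, a x ∂ν = 0

lemma eLpNorm_restrict_of_ae_eq_zero (hE : MeasurableSet E) (h : ∀ᵐ x ∂ν, x ∉ E → a x = 0) :
    eLpNorm a q (ν.restrict E) = eLpNorm a q ν := by
  rw [← eLpNorm_indicator_eq_eLpNorm_restrict hE]
  refine eLpNorm_congr_ae ?_
  filter_upwards [h] with x hx
  by_cases hxE : x ∈ E
  · simp [hxE]
  · simp [hxE, hx hxE]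

lemma IsAtomOn.congr {a' : X → ℂ} (h : IsAtomOn ν q E a) (ha : a =ᵐ[ν] a') :
    IsAtomOn ν q E a' := by
  obtain ⟨h1, h2, h3, h4⟩ := h
  refine ⟨(memLp_congr_ae ha).1 h1, ?_, (eLpNorm_congr_ae ha) ▸ h3, integral_congr_ae ha ▸ h4⟩
  filter_upwards [h2, ha] with x hx hx' hxE
  rw [← hx', hx hxE]

lemma IsAtomOn.congr_set {E' : Set X} (h : IsAtomOn ν q E a) (hE : E =ᵐ[ν] E') :
    IsAtomOn ν q E' a := by
  obtain ⟨h1, h2, h3, h4⟩ := h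
  refine ⟨h1, ?_, measure_congr hE ▸ h3, h4⟩
  filter_upwards [h2, hE.mem_iff] with x hx hx' hxE
  exact hx fun hx0 => hxE (hx'.1 hx0)

lemma IsAtomOn.zero : IsAtomOn ν q E 0 :=
  ⟨MemLp.zero, by simp, by simp, by simp⟩

/-- Hölder on `E`; the normalisation of atoms is chosen so that the powers of `ν E` match. -/
lemma IsAtomOn.of_le (h : IsAtomOn ν q E a) (hpq : p ≤ q) (hE : MeasurableSet E)
    (h0 : ν E ≠ 0) (htop : ν E ≠ ∞) : IsAtomOn ν p E a := by
  obtain ⟨h1, h2, h3, h4⟩ := h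
  have hle : eLpNorm a p ν ≤ ν E ^ ((p⁻¹).toReal - 1) := by
    have := eLpNorm_le_eLpNorm_mul_rpow_measure_univ hpq
      (h1.aestronglyMeasurable.restrict (s := E))
    rw [eLpNorm_restrict_of_ae_eq_zero hE h2, eLpNorm_restrict_of_ae_eq_zero hE h2,
      Measure.restrict_apply_univ] at this
    refine this.trans ((mul_le_mul_left h3 _).trans_eq ?_)
    rw [← ENNReal.rpow_add _ _ h0 htop]
    congr 1
    simp only [ENNReal.toReal_inv]
    ring
  exact ⟨⟨h1.1, hle.trans_lt ((ENNReal.rpow_ne_top_of_ne_zero h0 htop).lt_top)⟩, h2, hle, h4⟩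

lemma IsAtomOn.eLpNorm_one_le (h : IsAtomOn ν q E a) (hq : 1 ≤ q) (hE : MeasurableSet E)
    (h0 : ν E ≠ 0) (htop : ν E ≠ ∞) : eLpNorm a 1 ν ≤ 1 := by
  simpa using (h.of_le hq hE h0 htop).2.2.1

variable {f : X → ℂ} {N : ℝ≥0∞}

lemma eLpNorm_one_restrict_le (hq : 1 ≤ q) (hf : MemLp f q ν) (h0 : ν E ≠ 0) (htop : ν E ≠ ∞)
    (hN : eLpNorm f q (ν.restrict E) ≤ N * ν E ^ (q⁻¹).toReal) :
    eLpNorm f 1 (ν.restrict E) ≤ N * ν E := by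
  have := eLpNorm_le_eLpNorm_mul_rpow_measure_univ hq (hf.aestronglyMeasurable.restrict (s := E))
  refine this.trans ((mul_le_mul_left hN _).trans_eq ?_)
  rw [Measure.restrict_apply_univ, mul_assoc, ← ENNReal.rpow_add _ _ h0 htop, ENNReal.toReal_inv]
  simp

lemma enorm_setAverage_le (hq : 1 ≤ q) (hf : MemLp f q ν) (h0 : ν E ≠ 0) (htop : ν E ≠ ∞)
    (hN : eLpNorm f q (ν.restrict E) ≤ N * ν E ^ (q⁻¹).toReal) :
    ‖⨍ x in E, f x ∂ν‖ₑ ≤ N := by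
  have h1 := eLpNorm_one_restrict_le hq hf h0 htop hN
  rw [eLpNorm_one_eq_lintegral_enorm] at h1
  rw [setAverage_eq, enorm_smul]
  have h2 : ‖(ν.real E)⁻¹‖ₑ = (ν E)⁻¹ := by
    rw [Real.enorm_eq_ofReal (by positivity), measureReal_def, ← ENNReal.toReal_inv,
      ENNReal.ofReal_toReal (ENNReal.inv_ne_top.2 h0)]
  rw [h2]
  calc (ν E)⁻¹ * ‖∫ x in E, f x ∂ν‖ₑ ≤ (ν E)⁻¹ * (N * ν E) := by
        gcongr
        exact (enorm_integral_le_lintegral_enorm _).trans h1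
    _ = N := by
        rw [mul_comm, mul_assoc, ENNReal.mul_inv_cancel h0 htop, mul_one]

/-- Subtracting its mean over `E` turns `f` into a multiple of an atom on `E`. -/
lemma isAtomOn_indicator_sub_average (hq : 1 ≤ q) (hq' : q ≠ ∞) (hf : MemLp f q ν)
    (hE : MeasurableSet E) (h0 : ν E ≠ 0) (htop : ν E ≠ ∞) (hN0 : N ≠ 0) (hNtop : N ≠ ∞)
    (hN : eLpNorm f q (ν.restrict E) ≤ N * ν E ^ (q⁻¹).toReal) :
    IsAtomOn ν q E fun x => ((2 * N * ν E).toReal⁻¹ : ℂ) *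
      E.indicator (fun y => f y - ⨍ z in E, f z ∂ν) x := by
  set c := ⨍ z in E, f z ∂ν with hc
  have hc1 : ‖c‖ₑ ≤ N := enorm_setAverage_le hq hf h0 htop hN
  have hq0 : q ≠ 0 := (zero_lt_one.trans_le hq).ne'
  have : IsFiniteMeasure (ν.restrict E) := ⟨by simpa using htop.lt_top⟩
  have hmem : MemLp (E.indicator fun y => f y - c) q ν := by
    rw [memLp_indicator_iff_restrict hE]
    exact (hf.restrict E).sub (memLp_const c)
  have hnorm : eLpNorm (E.indicator fun y => f y - c) q ν ≤ 2 * N * ν E ^ (q⁻¹).toReal := by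
    rw [eLpNorm_indicator_eq_eLpNorm_restrict hE]
    -- The function and its mean each contribute `N * ν E ^ (1 / q)`, hence the factor `2`.
    refine (eLpNorm_sub_le (hf.restrict E).1 aestronglyMeasurable_const hq).trans ?_
    rw [two_mul, add_mul]
    refine add_le_add hN ?_
    rw [eLpNorm_const' _ hq0 hq', Measure.restrict_apply_univ, ENNReal.toReal_inv, one_div]
    gcongr
  have hk0 : 2 * N * ν E ≠ 0 := by simp [hN0, h0]
  have hktop : 2 * N * ν E ≠ ∞ := by finiteness
  refine ⟨hmem.const_mul _, ?_, ?_, ?_⟩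
  · exact Eventually.of_forall fun x hx => by simp [hx]
  · have hk : ‖((2 * N * ν E).toReal⁻¹ : ℂ)‖ₑ = (2 * N * ν E)⁻¹ := by
      rw [← Complex.ofReal_inv, ← ENNReal.toReal_inv]
      rw [← ofReal_norm, Complex.norm_real, Real.norm_of_nonneg ENNReal.toReal_nonneg,
        ENNReal.ofReal_toReal (ENNReal.inv_ne_top.2 hk0)]
    have := eLpNorm_const_smul ((2 * N * ν E).toReal⁻¹ : ℂ) (E.indicator fun y => f y - c) q ν
    simp only [Pi.smul_def, smul_eq_mul] at this
    rw [this, hk]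
    refine (mul_le_mul_right hnorm _).trans_eq ?_
    rw [ENNReal.rpow_sub _ _ h0 htop, ENNReal.rpow_one, ENNReal.div_eq_inv_mul,
      ENNReal.mul_inv (Or.inr htop) (Or.inr h0)]
    have hN2 : 2 * N ≠ 0 := by simp [hN0]
    have hN2' : 2 * N ≠ ∞ := by finiteness
    calc (2 * N)⁻¹ * (ν E)⁻¹ * (2 * N * ν E ^ (q⁻¹).toReal)
        = ((2 * N)⁻¹ * (2 * N)) * ((ν E)⁻¹ * ν E ^ (q⁻¹).toReal) := by ring
      _ = _ := by rw [ENNReal.inv_mul_cancel hN2 hN2', one_mul]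
  · rw [integral_const_mul, integral_indicator hE, integral_sub ((hf.restrict E).integrable hq)
      (integrable_const c), setIntegral_const, hc, setAverage_eq, smul_smul,
      mul_inv_cancel₀, one_smul, sub_self, mul_zero]
    exact ENNReal.toReal_ne_zero.2 ⟨h0, htop⟩

lemma IsAtomicSum.of_denumerable {V : Type*} [NormedAddCommGroup V] [NormedSpace ℂ V]
    {S : Set V} {ι : Type*} [Denumerable ι] {α : ι → ℂ} {u : ι → V} {c : ℝ} {f : V}
    (hu : ∀ i, u i ∈ S) (hα : Summable fun i => ‖α i‖) (hc : ∑' i, ‖α i‖ ≤ c)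
    (hf : HasSum (fun i => α i • u i) f) : IsAtomicSum S c f := by
  have e : ℕ ≃ ι := (Denumerable.eqv ι).symm
  refine ⟨α ∘ e, u ∘ e, fun i => hu _, e.summable_iff.2 hα, ?_, e.hasSum_iff.2 hf⟩
  exact (e.tsum_eq fun i => ‖α i‖).trans_le hc

end AtomOn

/-! ### Calderón–Zygmund decomposition of an atom -/

section Approx

/-- Since `r⁻¹ < 1`, `B` outgrows `(4 * B) ^ r⁻¹`. The choice `B ^ (1 - r⁻¹) = 16` suffices because
`4 * 4 ^ r⁻¹ ≤ 16`. The condition `4 * C ≤ B` is what bounds the coefficients `2 * C / B` by `1 /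
2`. -/
lemma exists_threshold {r : ℝ} (hr : 1 < r) :
    ∃ B C : ℝ, 1 ≤ B ∧ 0 < C ∧ C = (4 * B) ^ r⁻¹ ∧ 4 * C ≤ B := by
  have hr0 : 0 < r := by linarith
  have hr1 : 0 < 1 - r⁻¹ := by
    have := inv_lt_one_of_one_lt₀ hr
    linarith
  set B : ℝ := 16 ^ (1 - r⁻¹)⁻¹ with hB
  have hB1 : 1 ≤ B := Real.one_le_rpow (by norm_num) (inv_nonneg.2 hr1.le)
  have hB0 : 0 < B := by linarith
  refine ⟨B, (4 * B) ^ r⁻¹, hB1, by positivity, rfl, ?_⟩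
  have h16 : B ^ (1 - r⁻¹) = 16 := by
    rw [hB, Real.rpow_inv_rpow (by norm_num) hr1.ne']
  have hsplit : B = B ^ (1 - r⁻¹) * B ^ r⁻¹ := by
    rw [← Real.rpow_add hB0]; simp
  have h4 : (4 : ℝ) ^ r⁻¹ ≤ 4 := by
    conv_rhs => rw [← Real.rpow_one 4]
    exact Real.rpow_le_rpow_of_exponent_le (by norm_num) (inv_le_one_of_one_le₀ hr.le)
  rw [Real.mul_rpow (by norm_num) hB0.le]
  have hBr : 0 ≤ B ^ r⁻¹ := by positivity
  calc 4 * (4 ^ r⁻¹ * B ^ r⁻¹) ≤ 4 * (4 * B ^ r⁻¹) := by gcongr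
    _ = B ^ (1 - r⁻¹) * B ^ r⁻¹ := by rw [h16]; ring
    _ = B := hsplit.symm

lemma tsum_apply_of_disjoint_support {X ι : Type*} {b : ι → X → ℂ} {E : ι → Set X}
    (hE : Pairwise (Function.onFun Disjoint E)) (hb : ∀ i, ∀ x ∉ E i, b i x = 0) {i : ι} {x : X}
    (hx : x ∈ E i) : ∑' j, b j x = b i x :=
  tsum_eq_single i fun j hj => hb j x fun hxj => Set.disjoint_left.1 (hE hj) hxj hx

variable {X : Type*} [MeasurableSpace X] {ν : Measure X} {R : Set X} {π : ℕ → X → ℤ × ℤ}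

/-- The Calderón–Zygmund decomposition of a `q`-atom: up to a series of `q`-atoms on cells with
coefficients of total size at most `1 / 2`, it is a multiple of an `∞`-atom. -/
theorem IsDyadicGrid.exists_approx (hG : IsDyadicGrid ν R π) {q : ℝ≥0∞} (hq : 1 < q)
    (hq' : q ≠ ∞) {B C : ℝ} (hB : 1 ≤ B) (hC : 0 < C) (hCB : C = (4 * B) ^ q.toReal⁻¹)
    (hBC : 4 * C ≤ B) {f : Lp ℂ 1 ν} (hf : IsAtomOn ν q R f) :
    ∃ v : Lp ℂ 1 ν, IsAtomOn ν ∞ R v ∧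
      IsAtomicSum {u : Lp ℂ 1 ν | ∃ n, ∃ x ∈ R, IsAtomOn ν q (cell R π n x) u} (1 / 2)
        (f - (C : ℂ) • v) := by
  have hRm := hG.measurableSet
  have hR0 := hG.measure_ne_zero
  have hRtop := hG.measure_ne_top
  have hq0 : q ≠ 0 := (zero_lt_one.trans hq).ne'
  have hr0 : 0 < q.toReal := ENNReal.toReal_pos hq0 hq'
  have hB0 : 0 < B := by linarith
  -- A measurable representative vanishing everywhere off `R`, so that the stopping argument works
  -- pointwise.
  obtain ⟨f₀, hf₀m, hf₀R, hff₀⟩ : ∃ f₀ : X → ℂ, Measurable f₀ ∧ (∀ x ∉ R, f₀ x = 0) ∧ f =ᵐ[ν] f₀ := by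
    have hsm := (Lp.stronglyMeasurable f).measurable
    refine ⟨R.indicator f, hsm.indicator hRm, fun x hx => indicator_of_notMem hx _, ?_⟩
    filter_upwards [hf.2.1] with x hx
    by_cases hxR : x ∈ R
    · simp [hxR]
    · simp [hxR, hx hxR]
  have hf₀ : IsAtomOn ν q R f₀ := hf.congr hff₀
  -- the threshold
  set M : ℝ≥0∞ := ν R ^ (-q.toReal) with hM
  have hM0 : M ≠ 0 := by simp [hM, ENNReal.rpow_eq_zero_iff, hR0, hRtop]
  have hMtop : M ≠ ∞ := ENNReal.rpow_ne_top_of_ne_zero hR0 hRtop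
  -- `N` equals `(4 * τ) ^ (1 / q)`: it bounds the normalised `L^q` mean of `f₀` on each stopping
  -- cell and, almost everywhere, the good part.
  set N : ℝ≥0∞ := ENNReal.ofReal C * (ν R)⁻¹ with hN
  have hN0 : N ≠ 0 := mul_ne_zero (by simpa using hC) (ENNReal.inv_ne_zero.2 hRtop)
  have hNtop : N ≠ ∞ := ENNReal.mul_ne_top ENNReal.ofReal_ne_top (ENNReal.inv_ne_top.2 hR0)
  set τ : ℝ≥0∞ := ENNReal.ofReal B * M with hτ
  have hBpos : ENNReal.ofReal B ≠ 0 := by simpa using hB0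
  have hτ0 : τ ≠ 0 := mul_ne_zero hBpos hM0
  have hτtop : τ ≠ ∞ := ENNReal.mul_ne_top ENNReal.ofReal_ne_top hMtop
  have hτN : (4 * τ) ^ q.toReal⁻¹ = N := by
    rw [hτ, ← mul_assoc, ENNReal.mul_rpow_of_nonneg _ _ (inv_nonneg.2 hr0.le), hM,
      ← ENNReal.rpow_mul, neg_mul, mul_inv_cancel₀ hr0.ne', ENNReal.rpow_neg_one, hN, hCB,
      ← ENNReal.ofReal_rpow_of_pos (by positivity), ENNReal.ofReal_mul (by norm_num)]
    simp
  have hint : ∫⁻ y, ‖f₀ y‖ₑ ^ q.toReal ∂ν ≤ M * ν R := by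
    have h1 := hf₀.2.2.1
    rw [eLpNorm_eq_lintegral_rpow_enorm_toReal hq0 hq', one_div] at h1
    rw [ENNReal.rpow_inv_le_iff hr0, ← ENNReal.rpow_mul] at h1
    refine h1.trans_eq ?_
    nth_rewrite 2 [← ENNReal.rpow_one (ν R)]
    rw [hM, ← ENNReal.rpow_add _ _ hR0 hRtop, ENNReal.toReal_inv]
    congr 1
    field_simp
    ring
  have hintR : ∫⁻ y in R, ‖f₀ y‖ₑ ^ q.toReal ∂ν ≤ τ * ν R := by
    refine (setLIntegral_le_lintegral _ _).trans (hint.trans ?_)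
    rw [hτ, mul_assoc]
    exact le_mul_of_one_le_left' (by simpa using hB)
  obtain ⟨E, hEm, hEd, hEc, hElow, hEup, hEgood⟩ :=
    hG.exists_stopping_cells (hf₀m.enorm.pow_const q.toReal) hτtop hintR
  have hER : ∀ i, E i ⊆ R := by
    intro i
    rcases hEc i with h | ⟨n, x, -, h⟩
    · simp [h]
    · rw [h]; exact cell_subset n x
  have hEtop : ∀ i, ν (E i) ≠ ∞ := fun i => measure_ne_top_of_subset (hER i) hRtop
  have hEN : ∀ i, eLpNorm f₀ q (ν.restrict (E i)) ≤ N * ν (E i) ^ (q⁻¹).toReal := by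
    intro i
    rw [eLpNorm_eq_lintegral_rpow_enorm_toReal hq0 hq', one_div, ENNReal.toReal_inv, ← hτN,
      ← ENNReal.mul_rpow_of_nonneg _ _ (inv_nonneg.2 hr0.le)]
    exact ENNReal.rpow_le_rpow (hEup i) (inv_nonneg.2 hr0.le)
  -- the bad parts
  set b : ℕ × ℤ × ℤ → X → ℂ :=
    fun i => (E i).indicator fun y => f₀ y - ⨍ z in E i, f₀ z ∂ν with hb
  set α : ℕ × ℤ × ℤ → ℝ≥0∞ := fun i => 2 * N * ν (E i) with hα
  have hαtop : ∀ i, α i ≠ ∞ := fun i =>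
    ENNReal.mul_ne_top (ENNReal.mul_ne_top (by simp) hNtop) (hEtop i)
  obtain ⟨x₀, hx₀⟩ : R.Nonempty := nonempty_of_measure_ne_zero hR0
  have hu : ∀ i, ∃ u : Lp ℂ 1 ν, (∃ n, ∃ x ∈ R, IsAtomOn ν q (cell R π n x) u) ∧ ‖u‖ ≤ 1 ∧
      ⇑(((α i).toReal : ℂ) • u) =ᵐ[ν] b i := by
    intro i
    rcases hEc i with h | ⟨n, x, hx, h⟩
    · refine ⟨0, ⟨0, x₀, hx₀, IsAtomOn.zero.congr (Lp.coeFn_zero ℂ 1 ν).symm⟩, by simp, ?_⟩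
      rw [smul_zero]
      have hb0 : b i = 0 := by ext; simp [hb, h]
      rw [hb0]
      exact Lp.coeFn_zero ℂ 1 ν
    · have h0 : ν (E i) ≠ 0 := by
        rw [h, hG.measure_cell n x hx]
        simp [hR0]
      have hat := isAtomOn_indicator_sub_average hq.le hq' hf₀.1 (hEm i) h0 (hEtop i) hN0 hNtop
        (hEN i)
      have hat1 := hat.of_le hq.le (hEm i) h0 (hEtop i)
      refine ⟨hat1.1.toLp _, ⟨n, x, hx, ?_⟩, ?_, ?_⟩
      · rw [← h]
        exact hat.congr hat1.1.coeFn_toLp.symm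
      · rw [Lp.norm_toLp]
        exact ENNReal.toReal_le_of_le_ofReal zero_le_one
          (by simpa using hat.eLpNorm_one_le hq.le (hEm i) h0 (hEtop i))
      · have hα0 : (α i).toReal ≠ 0 :=
          ENNReal.toReal_ne_zero.2 ⟨by simp [hα, hN0, h0], hαtop i⟩
        filter_upwards [Lp.coeFn_smul ((α i).toReal : ℂ) (hat1.1.toLp _),
          hat1.1.coeFn_toLp] with y hy hy'
        rw [hy, Pi.smul_apply, hy', smul_eq_mul, ← mul_assoc, mul_inv_cancel₀
          (by exact_mod_cast hα0), one_mul]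
  choose u huS hu1 hub using hu
  have hαsum : ∑' i, α i ≤ ENNReal.ofReal (1 / 2) := by
    -- Chebyshev: `|f₀|^q` has average at least `τ` on each of the disjoint cells, so their total
    -- measure is at most `ν R / B`.
    have h1 : τ * ∑' i, ν (E i) ≤ M * ν R := by
      rw [← ENNReal.tsum_mul_left]
      refine (ENNReal.tsum_le_tsum hElow).trans ?_
      rw [← lintegral_iUnion hEm hEd]
      exact (setLIntegral_le_lintegral _ _).trans hint
    have h2 : ∑' i, ν (E i) ≤ (ENNReal.ofReal B)⁻¹ * ν R := by
      rw [← ENNReal.mul_le_mul_iff_right hτ0 hτtop]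
      refine h1.trans_eq ?_
      rw [hτ]
      calc M * ν R = (ENNReal.ofReal B * (ENNReal.ofReal B)⁻¹) * (M * ν R) := by
            rw [ENNReal.mul_inv_cancel hBpos ENNReal.ofReal_ne_top, one_mul]
        _ = _ := by ring
    rw [hα, ENNReal.tsum_mul_left]
    refine (mul_le_mul_right h2 _).trans ?_
    calc 2 * N * ((ENNReal.ofReal B)⁻¹ * ν R)
        = 2 * ENNReal.ofReal C * (ENNReal.ofReal B)⁻¹ * ((ν R)⁻¹ * ν R) := by rw [hN]; ring
      _ = ENNReal.ofReal (2 * C * B⁻¹) := by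
          rw [ENNReal.inv_mul_cancel hR0 hRtop, mul_one, ENNReal.ofReal_mul (by positivity),
            ENNReal.ofReal_mul (by positivity), ENNReal.ofReal_inv_of_pos hB0]
          simp
      _ ≤ _ := by
          apply ENNReal.ofReal_le_ofReal
          rw [← div_eq_mul_inv, div_le_div_iff₀ hB0 (by norm_num)]
          linarith
  have hαtsum : ∑' i, α i ≠ ∞ := ne_top_of_le_ne_top ENNReal.ofReal_ne_top hαsum
  have hnormα : ∀ i, ‖((α i).toReal : ℂ)‖ = (α i).toReal := fun i => by
    rw [Complex.norm_real, Real.norm_of_nonneg ENNReal.toReal_nonneg]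
  have hαs : Summable fun i => ‖((α i).toReal : ℂ)‖ := by
    simp only [hnormα]
    exact ENNReal.summable_toReal hαtsum
  have hαle : ∑' i, ‖((α i).toReal : ℂ)‖ ≤ 1 / 2 := by
    simp only [hnormα]
    rw [← ENNReal.tsum_toReal_eq hαtop]
    exact ENNReal.toReal_le_of_le_ofReal (by norm_num) hαsum
  have hUs : Summable fun i => ((α i).toReal : ℂ) • u i :=
    (summable_smul_of_norm_le_one (S := {u | ‖u‖ ≤ 1}) (fun _ h => h) hu1 hαs).of_norm
  have hUe : ∑' i, ‖((α i).toReal : ℂ) • u i‖ₑ ≠ ∞ := by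
    refine ne_top_of_le_ne_top hαtsum (ENNReal.tsum_le_tsum fun i => ?_)
    rw [← ofReal_norm, norm_smul, hnormα, ← ENNReal.ofReal_toReal (hαtop i)]
    apply ENNReal.ofReal_le_ofReal
    rw [ENNReal.toReal_ofReal ENNReal.toReal_nonneg]
    exact mul_le_of_le_one_right ENNReal.toReal_nonneg (hu1 i)
  set s : Lp ℂ 1 ν := ∑' i, ((α i).toReal : ℂ) • u i with hs
  have hsae : ∀ᵐ x ∂ν, s x = ∑' i, b i x := by
    filter_upwards [Lp.coeFn_tsum hUe, ae_all_iff.2 hub] with x hx hx'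
    rw [hs, hx]
    exact tsum_congr hx'
  have hbE : ∀ i, ∀ x ∉ E i, b i x = 0 := fun i x hx => indicator_of_notMem hx _
  -- the good part
  have hgood : ∀ᵐ x ∂ν, ‖(f - s) x‖ₑ ≤ N ∧ (x ∉ R → (f - s) x = 0) := by
    filter_upwards [Lp.coeFn_sub f s, hsae, hff₀, hEgood] with x h1 h2 h3 h4
    rw [h1, Pi.sub_apply, h2, h3]
    by_cases hx : ∃ i, x ∈ E i
    · obtain ⟨i, hi⟩ := hx
      rw [tsum_apply_of_disjoint_support hEd hbE hi]
      -- On a stopping cell only the mean of `f₀` survives. Elsewhere in `R`, differentiation gives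
      -- `|f₀|^q ≤ τ`.
      simp only [hb, indicator_of_mem hi, sub_sub_cancel]
      refine ⟨?_, fun hxR => absurd (hER i hi) hxR⟩
      have h0 : ν (E i) ≠ 0 := by
        rcases hEc i with h | ⟨n, y, hy, h⟩
        · simp [h] at hi
        · rw [h, hG.measure_cell n y hy]
          simp [hR0]
      exact enorm_setAverage_le hq.le hf₀.1 h0 (hEtop i) (hEN i)
    · push Not at hx
      have hz : ∑' i, b i x = 0 := by
        simp only [hbE _ x (hx _), tsum_zero]
      rw [hz, sub_zero]
      refine ⟨?_, fun hxR => hf₀R x hxR⟩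
      by_cases hxR : x ∈ R
      · have h5 := h4 hxR hx
        rw [← hτN, ENNReal.le_rpow_inv_iff hr0]
        exact h5.trans (le_mul_of_one_le_left' (by norm_num))
      · simp [hf₀R x hxR]
  -- The integral is continuous on `L¹`, so it may be taken term by term.
  have hsint : ∫ x, s x ∂ν = 0 := by
    have h1 := hUs.hasSum.mapL (L1.integralCLM (E := ℂ) (μ := ν))
    have h2 : ∀ i, L1.integralCLM (((α i).toReal : ℂ) • u i) = 0 := by
      intro i
      obtain ⟨n, x, -, hx⟩ := huS i
      rw [← L1.integral_eq, L1.integral_eq_integral,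
        integral_congr_ae (Lp.coeFn_smul ((α i).toReal : ℂ) (u i))]
      simp only [Pi.smul_apply, integral_smul, hx.2.2.2, smul_zero]
    simp only [h2] at h1
    rw [← L1.integral_eq_integral, L1.integral_eq]
    exact h1.unique hasSum_zero
  have hfint : ∫ x, (f - s) x ∂ν = 0 := by
    rw [integral_congr_ae (Lp.coeFn_sub f s)]
    simp only [Pi.sub_apply]
    rw [integral_sub (L1.integrable_coeFn f) (L1.integrable_coeFn s), hf.2.2.2, hsint, sub_zero]
  have hCC : (C : ℂ) ≠ 0 := by exact_mod_cast hC.ne'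
  have hv := Lp.coeFn_smul ((C : ℂ)⁻¹) (f - s)
  have hvN : eLpNorm ((C : ℂ)⁻¹ • (f - s) : Lp ℂ 1 ν) ∞ ν ≤ (ν R)⁻¹ := by
    rw [eLpNorm_exponent_top]
    refine eLpNormEssSup_le_of_ae_enorm_bound ?_
    filter_upwards [hgood, hv] with x hx hx'
    rw [hx', Pi.smul_apply, enorm_smul]
    have hCe : ‖(C : ℂ)⁻¹‖ₑ = (ENNReal.ofReal C)⁻¹ := by
      rw [← Complex.ofReal_inv, ← ofReal_norm, Complex.norm_real,
        Real.norm_of_nonneg (by positivity), ENNReal.ofReal_inv_of_pos hC]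
    rw [hCe]
    refine (mul_le_mul_right hx.1 _).trans_eq ?_
    rw [hN, ← mul_assoc, ENNReal.inv_mul_cancel (by simpa using hC) ENNReal.ofReal_ne_top, one_mul]
  refine ⟨(C : ℂ)⁻¹ • (f - s), ⟨⟨Lp.aestronglyMeasurable _,
    hvN.trans_lt (ENNReal.inv_lt_top.2 (pos_iff_ne_zero.2 hR0))⟩, ?_, ?_, ?_⟩, ?_⟩
  · filter_upwards [hgood, hv] with x hx hx' hxR
    rw [hx', Pi.smul_apply, hx.2 hxR, smul_zero]
  · simpa [ENNReal.rpow_neg_one] using hvN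
  · rw [integral_congr_ae hv]
    simp only [Pi.smul_apply, integral_smul, hfint, smul_zero]
  · rw [smul_inv_smul₀ hCC, sub_sub_cancel]
    exact IsAtomicSum.of_denumerable huS hαs hαle hUs.hasSum

end Approx

/-! ### The dyadic grid of the unit square and its pullback -/

section Dyadic

/-- The label of the dyadic square of side length `2⁻ⁿ` which contains `y`. -/
def dyadicLabel (n : ℕ) (y : ℝ × ℝ) : ℤ × ℤ :=
  (⌊2 ^ n * y.1⌋, ⌊2 ^ n * y.2⌋)

/-- The open dyadic square with label `k`. -/
def dyadicSquare (n : ℕ) (k : ℤ × ℤ) : Set (ℝ × ℝ) :=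
  Ioo ((k.1 : ℝ) / 2 ^ n) ((k.1 + 1) / 2 ^ n) ×ˢ Ioo ((k.2 : ℝ) / 2 ^ n) ((k.2 + 1) / 2 ^ n)

/-- The centre of the dyadic square with label `k`. -/
def dyadicCenter (n : ℕ) (k : ℤ × ℤ) : ℝ × ℝ :=
  ((k.1 + 1 / 2) / 2 ^ n, (k.2 + 1 / 2) / 2 ^ n)

lemma measurable_dyadicLabel (n : ℕ) : Measurable (dyadicLabel n) := by
  unfold dyadicLabel; fun_prop

lemma floor_two_pow_mul_eq_iff {n : ℕ} {t : ℝ} {k : ℤ} :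
    ⌊2 ^ n * t⌋ = k ↔ t ∈ Ico ((k : ℝ) / 2 ^ n) ((k + 1) / 2 ^ n) := by
  have h : (0 : ℝ) < 2 ^ n := by positivity
  rw [Int.floor_eq_iff, mem_Ico, div_le_iff₀ h, lt_div_iff₀ h, mul_comm t]

lemma dyadicLabel_nested (n : ℕ) {y z : ℝ × ℝ} (h : dyadicLabel (n + 1) y = dyadicLabel (n + 1) z) :
    dyadicLabel n y = dyadicLabel n z := by
  have key : ∀ t : ℝ, ⌊2 ^ n * t⌋ = ⌊2 ^ (n + 1) * t⌋ / 2 := by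
    intro t
    have := Int.floor_div_natCast (2 ^ (n + 1) * t) 2
    rw [← show (2 : ℝ) ^ (n + 1) * t / (2 : ℕ) = 2 ^ n * t by push_cast; ring, this]
    rfl
  simp only [dyadicLabel, Prod.mk.injEq] at h ⊢
  rw [key, key, key, key, h.1, h.2]
  exact ⟨rfl, rfl⟩

lemma dyadicLabel_preimage (n : ℕ) (k : ℤ × ℤ) :
    dyadicLabel n ⁻¹' {k} =
      Ico ((k.1 : ℝ) / 2 ^ n) ((k.1 + 1) / 2 ^ n) ×ˢ
        Ico ((k.2 : ℝ) / 2 ^ n) ((k.2 + 1) / 2 ^ n) := by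
  ext y
  rw [mem_preimage, mem_singleton_iff, dyadicLabel, mem_prod, Prod.ext_iff,
    floor_two_pow_mul_eq_iff, floor_two_pow_mul_eq_iff]

lemma dyadicLabel_preimage_ae_eq (n : ℕ) (k : ℤ × ℤ) :
    dyadicLabel n ⁻¹' {k} =ᵐ[volume] dyadicSquare n k := by
  rw [dyadicLabel_preimage, Measure.volume_eq_prod]
  exact Measure.set_prod_ae_eq Ioo_ae_eq_Ico.symm Ioo_ae_eq_Ico.symm

lemma dyadicCenter_closedBall (n : ℕ) (k : ℤ × ℤ) :
    Metric.closedBall (dyadicCenter n k) (1 / 2 / 2 ^ n) =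
      Icc ((k.1 : ℝ) / 2 ^ n) ((k.1 + 1) / 2 ^ n) ×ˢ
        Icc ((k.2 : ℝ) / 2 ^ n) ((k.2 + 1) / 2 ^ n) := by
  rw [dyadicCenter, ← closedBall_prod_same, Real.closedBall_eq_Icc, Real.closedBall_eq_Icc]
  congr 2 <;> ring

/-- Closed dyadic squares are balls of the sup metric, the form in which the differentiation theorem
can be applied to them. -/
lemma dyadicLabel_preimage_ae_eq_closedBall (n : ℕ) (k : ℤ × ℤ) :
    dyadicLabel n ⁻¹' {k} =ᵐ[volume] Metric.closedBall (dyadicCenter n k) (1 / 2 / 2 ^ n) := by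
  rw [dyadicLabel_preimage, dyadicCenter_closedBall, Measure.volume_eq_prod]
  exact Measure.set_prod_ae_eq Ico_ae_eq_Icc Ico_ae_eq_Icc

lemma volume_dyadicSquare (n : ℕ) (k : ℤ × ℤ) : volume (dyadicSquare n k) = (4 ^ n)⁻¹ := by
  rw [dyadicSquare, Measure.volume_eq_prod, Measure.prod_prod, Real.volume_Ioo, Real.volume_Ioo,
    ← ENNReal.ofReal_mul (by rw [← sub_div]; simp)]
  have h : ((k.1 + 1 : ℝ) / 2 ^ n - k.1 / 2 ^ n) * ((k.2 + 1) / 2 ^ n - k.2 / 2 ^ n)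
      = (4 ^ n)⁻¹ := by
    rw [← sub_div, ← sub_div, show (4 : ℝ) = 2 * 2 by norm_num, mul_pow]
    field_simp
    ring
  rw [h, ENNReal.ofReal_inv_of_pos (by positivity), ENNReal.ofReal_pow (by norm_num)]
  simp

lemma volume_closedBall_dyadicCenter (n : ℕ) (k : ℤ × ℤ) :
    volume (Metric.closedBall (dyadicCenter n k) (1 / 2 / 2 ^ n)) = (4 ^ n)⁻¹ := by
  rw [← measure_congr (dyadicLabel_preimage_ae_eq_closedBall n k),
    measure_congr (dyadicLabel_preimage_ae_eq n k), volume_dyadicSquare]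

lemma floor_two_pow_mul_bounds (n : ℕ) {t : ℝ} (ht : t ∈ Ioo (0 : ℝ) 1) :
    0 ≤ (⌊2 ^ n * t⌋ : ℝ) / 2 ^ n ∧ ((⌊2 ^ n * t⌋ : ℝ) + 1) / 2 ^ n ≤ 1 := by
  have h : (0 : ℝ) < 2 ^ n := by positivity
  constructor
  · have : 0 ≤ ⌊2 ^ n * t⌋ := Int.floor_nonneg.2 (mul_nonneg h.le ht.1.le)
    exact div_nonneg (by exact_mod_cast this) h.le
  · have : ⌊2 ^ n * t⌋ < (2 : ℤ) ^ n := by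
      rw [Int.floor_lt]
      push_cast
      nlinarith [ht.2]
    rw [div_le_one h]
    exact_mod_cast this

lemma dyadicSquare_subset (n : ℕ) {y : ℝ × ℝ} (hy : y ∈ Ioo (0 : ℝ) 1 ×ˢ Ioo (0 : ℝ) 1) :
    dyadicSquare n (dyadicLabel n y) ⊆ Ioo (0 : ℝ) 1 ×ˢ Ioo (0 : ℝ) 1 := by
  obtain ⟨h1, h2⟩ := floor_two_pow_mul_bounds n hy.1
  obtain ⟨h3, h4⟩ := floor_two_pow_mul_bounds n hy.2
  exact prod_mono (Ioo_subset_Ioo h1 h2) (Ioo_subset_Ioo h3 h4)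

lemma mem_closedBall_dyadicCenter (n : ℕ) (y : ℝ × ℝ) :
    y ∈ Metric.closedBall (dyadicCenter n (dyadicLabel n y)) (1 / 2 / 2 ^ n) := by
  rw [dyadicCenter_closedBall]
  have h : y ∈ dyadicLabel n ⁻¹' {dyadicLabel n y} := rfl
  rw [dyadicLabel_preimage] at h
  exact ⟨Ico_subset_Icc_self h.1, Ico_subset_Icc_self h.2⟩

variable {X : Type*} [MeasurableSpace X] {ν : Measure X} {R : Set X} {Φ : X → ℝ × ℝ}

lemma cell_dyadicLabel_ae_eq (hR : MeasurableSet R) (hΦ : Measurable Φ)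
    (hmap : (ν.restrict R).map Φ = ν R • volume.restrict (Ioo (0 : ℝ) 1 ×ˢ Ioo (0 : ℝ) 1))
    (n : ℕ) (x : X) :
    cell R (fun n x => dyadicLabel n (Φ x)) n x =ᵐ[ν]
      (R ∩ Φ ⁻¹' dyadicSquare n (dyadicLabel n (Φ x)) : Set X) := by
  have hac : (ν.restrict R).map Φ ≪ volume := by
    rw [hmap]
    exact (Measure.restrict_le_self.absolutelyContinuous).smul_left _
  have hqmp : Measure.QuasiMeasurePreserving Φ (ν.restrict R) volume := ⟨hΦ, hac⟩
  have h := hqmp.preimage_ae_eq (dyadicLabel_preimage_ae_eq n (dyadicLabel n (Φ x)))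
  have h' := (ae_restrict_iff' hR).1 h.mem_iff
  refine eventuallyEq_set.2 ?_
  filter_upwards [h'] with y hy
  simp only [cell, mem_inter_iff]
  exact and_congr_right hy

/-- The pullback of the dyadic grid of the unit square under a map which preserves the measure up to
normalisation and is invertible on `R`. -/
theorem isDyadicGrid_of_map {T : ℝ × ℝ → X} (hR : MeasurableSet R) (hR0 : ν R ≠ 0)
    (hRtop : ν R ≠ ∞) (hΦ : Measurable Φ) (hT : Measurable T)
    (hΦR : ∀ x ∈ R, Φ x ∈ Ioo (0 : ℝ) 1 ×ˢ Ioo (0 : ℝ) 1) (hTΦ : ∀ x ∈ R, T (Φ x) = x)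
    (hmap : (ν.restrict R).map Φ = ν R • volume.restrict (Ioo (0 : ℝ) 1 ×ˢ Ioo (0 : ℝ) 1)) :
    IsDyadicGrid ν R fun n x => dyadicLabel n (Φ x) := by
  set U : Set (ℝ × ℝ) := Ioo (0 : ℝ) 1 ×ˢ Ioo (0 : ℝ) 1 with hU
  have hUm : MeasurableSet U := measurableSet_Ioo.prod measurableSet_Ioo
  have hQm : ∀ n k, MeasurableSet (dyadicLabel n ⁻¹' {k}) := fun n k =>
    measurable_dyadicLabel n (measurableSet_singleton k)
  have hcell : ∀ n, ∀ x ∈ R, ν (cell R (fun n x => dyadicLabel n (Φ x)) n x)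
      = (4 ^ n)⁻¹ * ν R := by
    intro n x hx
    have h1 : cell R (fun n x => dyadicLabel n (Φ x)) n x
        = Φ ⁻¹' (dyadicLabel n ⁻¹' {dyadicLabel n (Φ x)}) ∩ R := inter_comm _ _
    rw [h1, ← Measure.restrict_apply (hΦ (hQm _ _)), ← Measure.map_apply hΦ (hQm _ _), hmap,
      Measure.smul_apply, Measure.restrict_apply (hQm _ _), smul_eq_mul, mul_comm]
    congr 1
    rw [measure_congr ((dyadicLabel_preimage_ae_eq n _).inter (ae_eq_refl U)),
      inter_eq_left.2 (dyadicSquare_subset n (hΦR x hx)), volume_dyadicSquare]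
  refine ⟨hR, hR0, hRtop, fun n => (measurable_dyadicLabel n).comp hΦ,
    fun n x y h => dyadicLabel_nested n h, ?_, hcell, ?_⟩
  · intro x hx y hy
    have key : ∀ t ∈ Ioo (0 : ℝ) 1, ⌊2 ^ 0 * t⌋ = 0 := by
      intro t ht
      rw [pow_zero, one_mul, Int.floor_eq_zero_iff]
      exact ⟨ht.1.le, ht.2⟩
    simp only [dyadicLabel, key _ (hΦR x hx).1, key _ (hΦR x hx).2, key _ (hΦR y hy).1,
      key _ (hΦR y hy).2]
  · intro h hh hfin
    -- Move `h` to the unit square, where averages over dyadic squares are averages of `h` over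
    -- cells, and differentiate there.
    set h' : ℝ × ℝ → ℝ≥0∞ := U.indicator (h ∘ T) with hh'
    have hh'm : Measurable h' := (hh.comp hT).indicator hUm
    have htransport : ∀ Q : Set (ℝ × ℝ), MeasurableSet Q →
        ν R * ∫⁻ y in Q, h' y = ∫⁻ x in R ∩ Φ ⁻¹' Q, h x ∂ν := by
      intro Q hQ
      calc ν R * ∫⁻ y in Q, h' y = ν R * ∫⁻ y in Q, h (T y) ∂(volume.restrict U) := by
            rw [hh', lintegral_indicator hUm, Measure.restrict_restrict hUm,
              Measure.restrict_restrict hQ, inter_comm]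
            rfl
        _ = ∫⁻ y in Q, h (T y) ∂((ν.restrict R).map Φ) := by
            rw [hmap, Measure.restrict_smul, lintegral_smul_measure, smul_eq_mul]
        _ = ∫⁻ x in Φ ⁻¹' Q, h (T (Φ x)) ∂(ν.restrict R) :=
            setLIntegral_map hQ (hh.comp hT) hΦ
        _ = ∫⁻ x in R ∩ Φ ⁻¹' Q, h (T (Φ x)) ∂ν := by
            rw [Measure.restrict_restrict (hΦ hQ), inter_comm]
        _ = _ := setLIntegral_congr_fun (hR.inter (hΦ hQ)) fun x hx => by
            simp only [hTΦ x hx.1]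
    have hfin' : ∫⁻ y, h' y ≠ ∞ := by
      have h1 := htransport univ MeasurableSet.univ
      rw [Measure.restrict_univ, preimage_univ, inter_univ] at h1
      intro h2
      rw [h2, ENNReal.mul_top hR0] at h1
      exact hfin h1.symm
    have hac : (ν.restrict R).map Φ ≪ volume := by
      rw [hmap]
      exact (Measure.restrict_le_self.absolutelyContinuous).smul_left _
    have hdiff := (IsUnifLocDoublingMeasure.vitaliFamily (volume : Measure (ℝ × ℝ))
      1).ae_tendsto_lintegral_div hh'm.aemeasurable hfin'
    have hdiff' := ae_of_ae_map hΦ.aemeasurable (hac.ae_le hdiff)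
    rw [ae_restrict_iff' hR] at hdiff'
    filter_upwards [hdiff'] with x hx hxR B hB
    -- The balls are not centred at `Φ x`; it is enough that they contain it and shrink, hence the
    -- parameter `1` of the Vitali family.
    have hball : Tendsto (fun n : ℕ => Metric.closedBall (dyadicCenter n (dyadicLabel n (Φ x)))
        (1 / 2 / 2 ^ n : ℝ)) atTop
        ((IsUnifLocDoublingMeasure.vitaliFamily (volume : Measure (ℝ × ℝ)) 1).filterAt (Φ x)) := by
      refine IsUnifLocDoublingMeasure.tendsto_closedBall_filterAt _ _ _ ?_ ?_
      · refine tendsto_nhdsWithin_iff.2 ⟨?_, Eventually.of_forall fun n => ?_⟩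
        · have := (tendsto_pow_atTop_nhds_zero_of_lt_one (r := (1 / 2 : ℝ)) (by norm_num)
            (by norm_num)).const_mul (1 / 2)
          simpa [div_eq_mul_inv] using this
        · exact mem_Ioi.2 (by positivity)
      · refine Eventually.of_forall fun n => ?_
        rw [one_mul]
        exact mem_closedBall_dyadicCenter n (Φ x)
    have hlim := (hx hxR).comp hball
    have hval : h' (Φ x) = h x := by
      rw [hh', indicator_of_mem (hΦR x hxR), Function.comp_apply, hTΦ x hxR]
    rw [hval] at hlim
    refine le_of_tendsto hlim (Eventually.of_forall fun n => ?_)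
    simp only [Function.comp_apply]
    refine ENNReal.div_le_of_le_mul ?_
    rw [volume_closedBall_dyadicCenter, ← setLIntegral_congr
      (dyadicLabel_preimage_ae_eq_closedBall n _), ← ENNReal.mul_le_mul_iff_right hR0 hRtop,
      htransport _ (hQm _ _)]
    refine (hB n).trans_eq ?_
    rw [hcell n x hxR]
    ring

end Dyadic

/-! ### Rectangles and their adapted grids -/

section Rectangle

variable {lam : ℝ}

/-- Truncation at `0` only moves the left endpoint to `max (x - t) 0`. Conversely an interval with
nonnegative left endpoint is centred at its positive midpoint. -/
lemma isRectangle_iff {R : Set (ℝ × ℝ)} :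
    IsRectangle R ↔ ∃ a b c d : ℝ, 0 ≤ a ∧ a < b ∧ 0 ≤ c ∧ c < d ∧ R = Ioo a b ×ˢ Ioo c d := by
  have h1 : ∀ x t : ℝ, interval x t = Ioo (max (x - t) 0) (x + t) := by
    intro x t
    ext y
    simp only [interval, mem_inter_iff, mem_Ioo, mem_Ioi, max_lt_iff]
    tauto
  constructor
  · rintro ⟨x₁, t₁, x₂, t₂, hx₁, ht₁, hx₂, ht₂, rfl⟩
    refine ⟨_, _, _, _, le_max_right _ _, ?_, le_max_right _ _, ?_, by rw [h1, h1]⟩ <;>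
    · refine max_lt ?_ ?_ <;> linarith
  · rintro ⟨a, b, c, d, ha, hab, hc, hcd, rfl⟩
    refine ⟨(a + b) / 2, (b - a) / 2, (c + d) / 2, (d - c) / 2, by linarith, by linarith,
      by linarith, by linarith, ?_⟩
    rw [h1, h1]
    congr 2
    · rw [max_eq_left] <;> linarith
    · ring
    · rw [max_eq_left] <;> linarith
    · ring

lemma isAtom_iff {q : ℝ≥0∞} {a : ℝ × ℝ → ℂ} :
    IsAtom lam q a ↔ ∃ R, IsRectangle R ∧ IsAtomOn (prodMeasure lam) q R a := by
  constructor
  · rintro ⟨h1, ⟨R, hR, h2, h3⟩, h4⟩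
    exact ⟨R, hR, h1, h2, h3, h4⟩
  · rintro ⟨R, hR, h1, h2, h3, h4⟩
    exact ⟨h1, ⟨R, hR, h2, h3⟩, h4⟩

lemma IsRectangle.measurableSet {R : Set (ℝ × ℝ)} (hR : IsRectangle R) : MeasurableSet R := by
  obtain ⟨a, b, c, d, -, -, -, -, rfl⟩ := isRectangle_iff.1 hR
  exact measurableSet_Ioo.prod measurableSet_Ioo

lemma IsRectangle.prodMeasure_ne (hlam : 0 < lam) {R : Set (ℝ × ℝ)} (hR : IsRectangle R) :
    prodMeasure lam R ≠ 0 ∧ prodMeasure lam R ≠ ∞ := by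
  obtain ⟨a, b, c, d, ha, hab, hc, hcd, rfl⟩ := isRectangle_iff.1 hR
  rw [prodMeasure, Measure.prod_prod]
  have h1 := measure_Ioo_pos_lt_top hlam ha hab
  have h2 := measure_Ioo_pos_lt_top hlam hc hcd
  exact ⟨mul_ne_zero h1.1.ne' h2.1.ne', ENNReal.mul_ne_top h1.2.ne h2.2.ne⟩

/-- Every rectangle carries a dyadic grid whose cells are rectangles up to null sets. -/
theorem IsRectangle.exists_isDyadicGrid (hlam : 0 < lam) {R : Set (ℝ × ℝ)} (hR : IsRectangle R) :
    ∃ π, IsDyadicGrid (prodMeasure lam) R π ∧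
      ∀ n, ∀ x ∈ R, ∃ R', IsRectangle R' ∧ cell R π n x =ᵐ[prodMeasure lam] R' := by
  have hRm := hR.measurableSet
  obtain ⟨hR0, hRtop⟩ := hR.prodMeasure_ne hlam
  obtain ⟨a, b, c, d, ha, hab, hc, hcd, rfl⟩ := isRectangle_iff.1 hR
  set Φ : ℝ × ℝ → ℝ × ℝ := Prod.map (cdf lam a b) (cdf lam c d) with hΦ
  have hΦm : Measurable Φ := measurable_cdf.prodMap measurable_cdf
  have hΦR : ∀ x ∈ Ioo a b ×ˢ Ioo c d, Φ x ∈ Ioo (0 : ℝ) 1 ×ˢ Ioo (0 : ℝ) 1 := fun x hx =>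
    ⟨cdf_mem_Ioo hlam ha hab hx.1, cdf_mem_Ioo hlam hc hcd hx.2⟩
  have hmap : ((prodMeasure lam).restrict (Ioo a b ×ˢ Ioo c d)).map Φ =
      prodMeasure lam (Ioo a b ×ˢ Ioo c d) •
        volume.restrict (Ioo (0 : ℝ) 1 ×ˢ Ioo (0 : ℝ) 1) := by
    rw [prodMeasure, ← Measure.prod_restrict, hΦ,
      ← Measure.map_prod_map _ _ measurable_cdf measurable_cdf, map_cdf_restrict hlam ha hab,
      map_cdf_restrict hlam hc hcd, Measure.prod_prod, Measure.prod_smul_left,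
      Measure.prod_smul_right, smul_smul, Measure.prod_restrict, ← Measure.volume_eq_prod]
  refine ⟨fun n x => dyadicLabel n (Φ x),
    isDyadicGrid_of_map (T := Prod.map (quantile lam a b) (quantile lam c d)) hRm hR0 hRtop hΦm
      (measurable_quantile.prodMap measurable_quantile) hΦR ?_ hmap, ?_⟩
  · intro x hx
    exact Prod.ext (quantile_cdf hlam ha hab (ha.trans hx.1.1.le))
      (quantile_cdf hlam hc hcd (hc.trans hx.2.1.le))
  · intro n x hx
    -- Cells are half-open so as to partition `R`, whereas rectangles are open; the boundaries are
    -- null. The open square pulls back to a product of intervals between quantiles.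
    refine ⟨_, ?_, cell_dyadicLabel_ae_eq hRm hΦm hmap n x⟩
    have hn : (0 : ℝ) < 2 ^ n := by positivity
    have hk₁ := floor_two_pow_mul_bounds n (hΦR x hx).1
    have hk₂ := floor_two_pow_mul_bounds n (hΦR x hx).2
    change 0 ≤ ((dyadicLabel n (Φ x)).1 : ℝ) / _ ∧ ((dyadicLabel n (Φ x)).1 + 1 : ℝ) / _ ≤ 1 at hk₁
    change 0 ≤ ((dyadicLabel n (Φ x)).2 : ℝ) / _ ∧ ((dyadicLabel n (Φ x)).2 + 1 : ℝ) / _ ≤ 1 at hk₂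
    generalize dyadicLabel n (Φ x) = k at hk₁ hk₂
    obtain ⟨h1, h2⟩ := hk₁
    obtain ⟨h3, h4⟩ := hk₂
    have hlt : ∀ k : ℤ, (k : ℝ) / 2 ^ n < (k + 1) / 2 ^ n := fun k =>
      div_lt_div_of_pos_right (by linarith) hn
    rw [hΦ, dyadicSquare, preimage_prod_map_prod, prod_inter_prod,
      Ioo_inter_preimage_cdf hlam ha hab h1 (hlt _) h2,
      Ioo_inter_preimage_cdf hlam hc hcd h3 (hlt _) h4]
    exact isRectangle_iff.2 ⟨_, _, _, _, quantile_nonneg hlam ha hab h1,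
      quantile_lt_quantile hlam ha hab h1 (hlt _), quantile_nonneg hlam hc hcd h3,
      quantile_lt_quantile hlam hc hcd h3 (hlt _), rfl⟩

end Rectangle

/-! ### Comparison of the two atomic norms -/

section Main

variable {lam : ℝ} {p q : ℝ≥0∞}

/-- The `q`-atoms, as elements of `L¹`. -/
def atomSet (lam : ℝ) (q : ℝ≥0∞) : Set (Lp ℂ 1 (prodMeasure lam)) :=
  {u | IsAtom lam q u}

lemma IsAtom.congr {a a' : ℝ × ℝ → ℂ} (h : IsAtom lam q a) (ha : a =ᵐ[prodMeasure lam] a') :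
    IsAtom lam q a' := by
  obtain ⟨R, hR, h⟩ := isAtom_iff.1 h
  exact isAtom_iff.2 ⟨R, hR, h.congr ha⟩

lemma IsAtom.of_le (hlam : 0 < lam) {a : ℝ × ℝ → ℂ} (h : IsAtom lam q a) (hpq : p ≤ q) :
    IsAtom lam p a := by
  obtain ⟨R, hR, h⟩ := isAtom_iff.1 h
  have h0 := hR.prodMeasure_ne hlam
  exact isAtom_iff.2 ⟨R, hR, h.of_le hpq hR.measurableSet h0.1 h0.2⟩

lemma IsAtom.eLpNorm_one_le (hlam : 0 < lam) {a : ℝ × ℝ → ℂ} (h : IsAtom lam q a) (hq : 1 ≤ q) :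
    eLpNorm a 1 (prodMeasure lam) ≤ 1 := by
  obtain ⟨R, hR, h⟩ := isAtom_iff.1 h
  have h0 := hR.prodMeasure_ne hlam
  exact h.eLpNorm_one_le hq hR.measurableSet h0.1 h0.2

lemma norm_le_one_of_mem_atomSet (hlam : 0 < lam) (hq : 1 ≤ q) :
    ∀ u ∈ atomSet lam q, ‖u‖ ≤ 1 := by
  intro u hu
  rw [Lp.norm_def]
  exact ENNReal.toReal_le_of_le_ofReal zero_le_one (by simpa using hu.eLpNorm_one_le hlam hq)

lemma tendsto_sum_range_iff {f : Lp ℂ 1 (prodMeasure lam)} {α : ℕ → ℂ} {a : ℕ → ℝ × ℝ → ℂ}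
    {u : ℕ → Lp ℂ 1 (prodMeasure lam)} (hu : ∀ i, u i =ᵐ[prodMeasure lam] a i) :
    Tendsto (fun n => ∑ i ∈ Finset.range n, α i • u i) atTop (𝓝 f) ↔
      Tendsto (fun n => eLpNorm (fun x => f x - ∑ i ∈ Finset.range n, α i * a i x) 1
        (prodMeasure lam)) atTop (𝓝 0) := by
  rw [Lp.tendsto_Lp_iff_tendsto_eLpNorm']
  refine tendsto_congr fun n => ?_
  rw [eLpNorm_sub_comm]
  refine eLpNorm_congr_ae ?_
  filter_upwards [Lp.coeFn_fun_finsetSum (Finset.range n) fun i => α i • u i, ae_all_iff.2 hu,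
    ae_all_iff.2 fun i => Lp.coeFn_smul (α i) (u i)] with x hx hux hsx
  simp only [Pi.sub_apply, hx, hsx, Pi.smul_apply, hux, smul_eq_mul]

/-- Atoms have `L¹` norm at most `1`, so the series converges absolutely and the limit of its
partial sums is its unconditional sum. -/
lemma IsAtomicDecomposition.isAtomicSum (hlam : 0 < lam) (hq : 1 ≤ q)
    {f : Lp ℂ 1 (prodMeasure lam)} {α : ℕ → ℂ} {a : ℕ → ℝ × ℝ → ℂ}
    (h : IsAtomicDecomposition lam q f α a) :
    IsAtomicSum (atomSet lam q) (∑' i, ‖α i‖) f := by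
  obtain ⟨ha, hα, hlim⟩ := h
  have hmem : ∀ i, MemLp (a i) 1 (prodMeasure lam) := fun i => ((ha i).of_le hlam hq).1
  have hu : ∀ i, (hmem i).toLp (a i) ∈ atomSet lam q := fun i =>
    (ha i).congr (hmem i).coeFn_toLp.symm
  refine ⟨α, fun i => (hmem i).toLp (a i), hu, hα, le_rfl, ?_⟩
  have hs := (summable_smul_of_norm_le_one (norm_le_one_of_mem_atomSet hlam hq) hu hα).of_norm
  have := (tendsto_sum_range_iff fun i => (hmem i).coeFn_toLp).2 hlim
  exact (hs.hasSum_iff_tendsto_nat).2 this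

lemma IsAtomicSum.exists_isAtomicDecomposition {f : Lp ℂ 1 (prodMeasure lam)} {c : ℝ}
    (h : IsAtomicSum (atomSet lam q) c f) :
    ∃ α a, IsAtomicDecomposition lam q f α a ∧ ∑' i, ‖α i‖ ≤ c := by
  obtain ⟨α, u, hu, hα, hc, hf⟩ := h
  exact ⟨α, fun i => u i, ⟨hu, hα,
    (tendsto_sum_range_iff fun i => ae_eq_refl _).1 hf.tendsto_sum_nat⟩, hc⟩

lemma littleHardyNorm_le {f : Lp ℂ 1 (prodMeasure lam)} {c : ℝ}
    (h : IsAtomicSum (atomSet lam q) c f) : littleHardyNorm lam q f ≤ c := by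
  obtain ⟨α, a, hd, hc⟩ := h.exists_isAtomicDecomposition
  rw [littleHardyNorm]
  refine le_trans (csInf_le ⟨0, ?_⟩ ⟨α, a, hd, rfl⟩) hc
  rintro s ⟨α, a, -, rfl⟩
  exact tsum_nonneg fun i => norm_nonneg _

lemma le_littleHardyNorm (hlam : 0 < lam) (hq : 1 ≤ q) {f : Lp ℂ 1 (prodMeasure lam)}
    (hf : f ∈ littleHardy lam q) {t : ℝ}
    (h : ∀ c, IsAtomicSum (atomSet lam q) c f → t ≤ c) : t ≤ littleHardyNorm lam q f := by
  obtain ⟨α, a, hd⟩ := hf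
  refine le_csInf ⟨_, α, a, hd, rfl⟩ ?_
  rintro s ⟨α, a, hd, rfl⟩
  exact h _ (hd.isAtomicSum hlam hq)

lemma mem_littleHardy_iff (hlam : 0 < lam) (hq : 1 ≤ q) {f : Lp ℂ 1 (prodMeasure lam)} :
    f ∈ littleHardy lam q ↔ ∃ c, IsAtomicSum (atomSet lam q) c f := by
  constructor
  · rintro ⟨α, a, hd⟩
    exact ⟨_, hd.isAtomicSum hlam hq⟩
  · rintro ⟨c, hc⟩
    obtain ⟨α, a, hd, -⟩ := hc.exists_isAtomicDecomposition
    exact ⟨α, a, hd⟩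

lemma IsAtomicSum.atomSet_of_le (hlam : 0 < lam) (hpq : p ≤ q) {f : Lp ℂ 1 (prodMeasure lam)}
    {c : ℝ} (h : IsAtomicSum (atomSet lam q) c f) : IsAtomicSum (atomSet lam p) c f := by
  obtain ⟨α, u, hu, h⟩ := h
  exact ⟨α, u, fun i => IsAtom.of_le hlam (hu i) hpq, h⟩

/-- The atomic norm of the `∞`-atoms is dominated by that of the `q`-atoms. -/
theorem exists_isAtomicSum_top (hlam : 0 < lam) (hq : 1 < q) (hq' : q < ∞) :
    ∃ C : ℝ, 0 < C ∧ ∀ (c : ℝ) (f : Lp ℂ 1 (prodMeasure lam)),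
      IsAtomicSum (atomSet lam q) c f → IsAtomicSum (atomSet lam ∞) (2 * C * c) f := by
  have hr : 1 < q.toReal := by
    simpa using (ENNReal.toReal_lt_toReal ENNReal.one_ne_top hq'.ne).2 hq
  -- `B` and `C` are fixed before any atom or rectangle, so the final constant is uniform.
  obtain ⟨B, C, hB, hC, hCB, hBC⟩ := exists_threshold hr
  refine ⟨C, hC, fun c f hf => IsAtomicSum.of_approx (norm_le_one_of_mem_atomSet hlam hq.le)
    (norm_le_one_of_mem_atomSet hlam le_top) hC.le (fun u hu => ?_) hf⟩
  obtain ⟨R, hR, hu⟩ := isAtom_iff.1 hu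
  obtain ⟨π, hG, hcell⟩ := hR.exists_isDyadicGrid hlam
  obtain ⟨v, hv, α, w, hw, h⟩ := hG.exists_approx hq hq'.ne hB hC hCB hBC hu
  refine ⟨v, isAtom_iff.2 ⟨R, hR, hv⟩, α, w, fun i => ?_, h⟩
  obtain ⟨n, x, hx, hwx⟩ := hw i
  obtain ⟨R', hR', hae⟩ := hcell n x hx
  exact isAtom_iff.2 ⟨R', hR', hwx.congr_set hae⟩

end Main

end Bessel

end

theorem mainTheorem8 (lam : ℝ) (hlam : 0 < lam) (q : ℝ≥0∞) (hq : 1 < q) (hq' : q < ∞) :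
    Bessel.littleHardy lam q = Bessel.littleHardy lam ∞ ∧
    ∃ c C : ℝ, 0 < c ∧ 0 < C ∧ ∀ f ∈ Bessel.littleHardy lam ∞,
      c * Bessel.littleHardyNorm lam ∞ f ≤ Bessel.littleHardyNorm lam q f ∧
      Bessel.littleHardyNorm lam q f ≤ C * Bessel.littleHardyNorm lam ∞ f := by
  obtain ⟨C, hC, happrox⟩ := Bessel.exists_isAtomicSum_top hlam hq hq'
  have heq : Bessel.littleHardy lam q = Bessel.littleHardy lam ∞ := by
    ext f
    rw [Bessel.mem_littleHardy_iff hlam hq.le, Bessel.mem_littleHardy_iff hlam le_top]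
    exact ⟨fun ⟨c, hc⟩ => ⟨_, happrox c f hc⟩, fun ⟨c, hc⟩ => ⟨c, hc.atomSet_of_le hlam le_top⟩⟩
  -- The factor `2` is the sum of the geometric series of the iteration; the upper constant is `1`
  -- because `∞`-atoms are `q`-atoms.
  refine ⟨heq, (2 * C)⁻¹, 1, by positivity, one_pos, fun f hf => ⟨?_, ?_⟩⟩
  · refine Bessel.le_littleHardyNorm hlam hq.le (heq ▸ hf) fun c hc => ?_
    rw [inv_mul_le_iff₀ (by positivity)]
    exact Bessel.littleHardyNorm_le (happrox c f hc)
  · rw [one_mul]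
    exact Bessel.le_littleHardyNorm hlam le_top hf fun c hc =>
      Bessel.littleHardyNorm_le (hc.atomSet_of_le hlam le_top)
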